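/- Let $\mathcal C$ be a semisimple $\mathbb C$-linear abelian category (every object is a finite direct sum of simple objects, $\mathrm{Hom}$ spaces are finite-dimensional) with a rigid braided monoidal structure with bilinear $\otimes$, simple unit object $\mathbf 1$ and braiding $R$, and a balancing: an automorphism $\theta$ of the identity functor with $\theta_{\mathbf 1}=\mathrm{id}$, $\theta_{X\otimes Y}=R_{YX}R_{XY}(\theta_X\otimes\theta_Y)$ and $\theta_{X^*}=(\theta_X)^*$. Let $A$ be a commutative associative unital algebra in $\mathcal C$, with product $\mu\colon A\otimes A\to A$ and unit $\iota\colon\mathbf 1\to A$, such that $\dim_{\mathbb C}\mathrm{Hom}(\mathbf 1,A)=1$, $\theta_A=\mathrm{id}$, and $A$ is rigid: $\dim A\neq0$ (categorical dimension) and for some $\varepsilon\colon A\to\mathbf 1$ with $\varepsilon\iota=\mathrm{id}$ the pairing $\varepsilon\mu\colon A\otimes A\to\mathbf 1$ is non-degenerate. Let $G$ be a finite group acting faithfully on $A$ by algebra automorphisms $\pi_g$, $g\in G$, with $A^G=\mathbf 1$ (i.e. $\iota$ is the inclusion of the $G$-invariants). Let $\mathrm{Rep}\,A$ be the category of left $A$-modules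 $(X,\mu_X)$ in $\mathcal C$, and $\mathrm{Rep}^0A$ its full subcategory of those $X$ with $\mu_XR_{XA}R_{AX}=\mu_X$. For $h\in G$ let $X^h$ be the $A$-module with the same underlying object and action $\mu_X(\pi_h\otimes\mathrm{id})$. Then $g[X]=[X^{g^{-1}}]$ defines actions of $G$ on the set $S$ of isomorphism classes of simple objects of $\mathrm{Rep}\,A$ and on the set $S^0$ of isomorphism classes of simple objects of $\mathrm{Rep}^0A$. Let $\mathcal D$ be the category of pairs $(X,\varphi_X)$, where $X\in\mathrm{Rep}\,A$ and $\varphi_X(g)\colon X\to X$, $g\in G$, are $\mathcal C$-morphisms with $\varphi_X(g)\mu_X=\mu_X(\pi_g\otimes\varphi_X(g))$, $\varphi_X(g)\varphi_X(h)=\varphi_X(gh)$ and $\varphi_X(1)=\mathrm{id}$; morphisms are the $A$-module morphisms commuting with all $\varphi(g)$. Let $\mathcal D^0\subset\mathcal D$ be the full subcategory of the pairs with $X\in\mathrm{Rep}^0A$. For a $G$-orbit $O$ in $S$ (resp. in $S^0$) choose representatives $X_s$ of the classes $s\in O$ and $A$-module isomorphisms $\varphi_s(g)\colon X_s^{g^{-1}}\to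 X_{gs}$. There is a unique 2-cocycle $\alpha$ of $G$ with values in the group $F^*[O]$ of non-vanishing complex functions on $O$ (with $(gf)(s)=f(g^{-1}s)$) such that $\varphi_{hs}(g)\varphi_s(h)=\alpha(g,h)(ghs)\,\varphi_s(gh)$ for all $g,h\in G$, $s\in O$. Let $\mathcal A_{\alpha^{-1}}(G,O)$ be the algebra with elements $\sum_{g\in G}f_gT_g$, $f_g\in F[O]$ (complex functions on $O$), and product determined by $T_gf=(gf)T_g$, $T_gT_h=\alpha(g,h)^{-1}T_{gh}$. For a finite-dimensional representation $V$ of it let $V=\bigoplus_{s\in O}V_s$ be the decomposition given by the action of $F[O]$, let $\varphi_{V_s}(g)\colon V_s\to V_{gs}$ be the action of $T_g$, and put $$X_{V,O}=\bigoplus_{s\in O}V_s\boxtimes X_s,\qquad \varphi(g)=\bigoplus_{s\in O}\varphi_{V_s}(g)\otimes\varphi_s(g),$$ an object of $\mathcal D$ (resp. of $\mathcal D^0$). Here $V_s\boxtimes X_s$ is the direct sum of copies of $X_s$ indexed by a basis of $V_s$. Then: 1. $\mathcal D$ and $\mathcal D^0$ are semisimple: they are abelian, and every object is a finite direct sum of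 simple objects. 2. For all choices of the $X_s$ and $\varphi_s(g)$, the simple objects of $\mathcal D$ (resp. $\mathcal D^0$) are, up to isomorphism, exactly the objects $X_{\lambda,O}=X_{V_\lambda,O}$, where $O$ runs over the $G$-orbits in $S$ (resp. $S^0$) and $V_\lambda$ over the irreducible representations of $\mathcal A_{\alpha^{-1}}(G,O)$. Moreover, if $X_{\lambda,O}\cong X_{\lambda',O'}$ then $O=O'$, and $X_{\lambda,O}\cong X_{\lambda',O}$ if and only if $V_\lambda\cong V_{\lambda'}$. -/

import Mathlib

open CategoryTheory CategoryTheory.Limits MonoidalCategory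

universe w v u

namespace Orbifold

set_option linter.unusedSectionVars false

noncomputable section

open scoped MonObj

/-! ### Semisimple categories -/

/-- A preadditive category is abelian: it has finite products, kernels and cokernels, and all
monomorphisms and epimorphisms are normal. -/
structure IsAbelianCat (E : Type u) [Category.{v} E] [Preadditive E] : Prop where
  hasFiniteProducts : HasFiniteProducts E
  hasKernels : HasKernels E
  hasCokernels : HasCokernels E
  normalMono : IsNormalMonoCategory E
  normalEpi : IsNormalEpiCategory E

/-- A preadditive category is semisimple: it is abelian and every object is a (possibly empty)
finite direct sum of simple objects. -/
structure IsSemisimpleCat (E : Type u) [Category.{v} E] [Preadditive E] : Prop where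
  isAbelian : IsAbelianCat E
  decomp : ∀ X : E, ∃ (n : ℕ) (L : Fin n → E) (b : Bicone L),
    Nonempty b.IsBilimit ∧ (∀ i, Simple (L i)) ∧ Nonempty (X ≅ b.pt)

/-! ### Twists and quantum dimensions -/

/-- A balancing (twist) on a rigid braided monoidal category. -/
structure Balancing (C : Type u) [Category.{v} C] [MonoidalCategory C] [BraidedCategory C]
    [RigidCategory C] where
  θ : 𝟭 C ≅ 𝟭 C
  unit : θ.hom.app (𝟙_ C) = 𝟙 (𝟙_ C)
  tensor : ∀ X Y : C, θ.hom.app (X ⊗ Y) =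
    (β_ X Y).hom ≫ (β_ Y X).hom ≫ (θ.hom.app X ⊗ₘ θ.hom.app Y)
  dual : ∀ X : C, θ.hom.app (Xᘁ) = (θ.hom.app X)ᘁ

/-- The categorical (quantum) dimension of an object, as an endomorphism of the unit. -/
def Balancing.dim {C : Type u} [Category.{v} C] [MonoidalCategory C] [BraidedCategory C]
    [RigidCategory C] (θ : Balancing C) (X : C) : 𝟙_ C ⟶ 𝟙_ C :=
  η_ X (Xᘁ) ≫ (θ.θ.hom.app X ▷ Xᘁ) ≫ (β_ X (Xᘁ)).hom ≫ ε_ X (Xᘁ)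

/-! ### Rigid algebras with a group of automorphisms -/

section Algebras

variable {C : Type u} [Category.{v} C] [MonoidalCategory C] [BraidedCategory C]
  [RigidCategory C] [Preadditive C] [Linear ℂ C]

/-- The algebra `A` is rigid: the unit is unique up to scalars, the pairing
`A ⊗ A ⟶ A ⟶ 𝟙` is non-degenerate, where `A ⟶ 𝟙` is a retraction of the unit, and
`dim A ≠ 0`. -/
structure IsRigidAlgebra (θ : Balancing C) (A : C) [MonObj A] : Prop where
  unique_unit : Module.finrank ℂ (𝟙_ C ⟶ A) = 1
  nondegenerate : ∃ e : A ⟶ 𝟙_ C, η[A] ≫ e = 𝟙 (𝟙_ C) ∧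
    ∃ p : ExactPairing A A, p.evaluation' = μ[A] ≫ e
  dim_ne_zero : θ.dim A ≠ 0

end Algebras

section Setup

variable {C : Type u} [Category.{v} C] [MonoidalCategory C] {A : C} [MonObj A]
  {G : Type w} [Group G]

/-- The underlying morphism `A ⟶ A` of `π_g`. -/
def autHom (π : G →* Aut (Mon.mk A)) (g : G) : A ⟶ A := (π g).hom.hom

instance (π : G →* Aut (Mon.mk A)) (g : G) : IsMonHom (autHom π g) :=
  (π g).hom.isMonHom_hom

lemma autHom_one (π : G →* Aut (Mon.mk A)) : autHom π 1 = 𝟙 A := by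
  simp only [autHom, map_one]; rfl

lemma autHom_mul (π : G →* Aut (Mon.mk A)) (g h : G) :
    autHom π (g * h) = autHom π h ≫ autHom π g := by
  simp only [autHom, map_mul]; rfl

/-- `A^G = 𝟙`: the unit of `A` is the universal morphism into `A` that is invariant under `G`. -/
def InvariantsEqUnit (π : G →* Aut (Mon.mk A)) : Prop :=
  ∀ (Y : C) (f : Y ⟶ A), (∀ g, f ≫ autHom π g = f) → ∃! k : Y ⟶ 𝟙_ C, k ≫ η[A] = f

end Setup

/-! ### The additive structure on `Rep A` -/

section ModPreadditive

variable {C : Type u} [Category.{v} C] [MonoidalCategory C] [Preadditive C]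
  [MonoidalPreadditive C] {A : C} [MonObj A]

lemma mod_smul_hom {M N : Mod C A} (f : M ⟶ N) : γ[A, M.X] ≫ f.hom = A ◁ f.hom ≫ γ[A, N.X] :=
  f.isModHom.smul_hom

/-- Morphisms of modules from equivariant morphisms. -/
def modHom {M N : Mod C A} (f : M.X ⟶ N.X) (h : γ[A, M.X] ≫ f = A ◁ f ≫ γ[A, N.X]) : M ⟶ N :=
  Mod.Hom.mk' f h

@[simp] lemma modHom_hom {M N : Mod C A} (f : M.X ⟶ N.X) (h) :
    (modHom f h : M ⟶ N).hom = f := rfl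

instance (M N : Mod C A) : Zero (M ⟶ N) := ⟨modHom 0 (by simp)⟩
instance (M N : Mod C A) : Add (M ⟶ N) :=
  ⟨fun f g => modHom (f.hom + g.hom) (by simp)⟩
instance (M N : Mod C A) : Neg (M ⟶ N) :=
  ⟨fun f => modHom (-f.hom) (by
    have : A ◁ (-f.hom) = -(A ◁ f.hom) := (tensorLeft A).map_neg
    simp [this])⟩
instance (M N : Mod C A) : Sub (M ⟶ N) :=
  ⟨fun f g => modHom (f.hom - g.hom) (by
    have : A ◁ (f.hom - g.hom) = A ◁ f.hom - A ◁ g.hom := (tensorLeft A).map_sub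
    simp [this])⟩
instance (M N : Mod C A) : SMul ℕ (M ⟶ N) :=
  ⟨fun n f => modHom (n • f.hom) (by
    have : A ◁ (n • f.hom) = n • (A ◁ f.hom) := (tensorLeft A).map_nsmul
    simp [this])⟩
instance (M N : Mod C A) : SMul ℤ (M ⟶ N) :=
  ⟨fun n f => modHom (n • f.hom) (by
    have : A ◁ (n • f.hom) = n • (A ◁ f.hom) := (tensorLeft A).map_zsmul
    simp [this])⟩

instance (M N : Mod C A) : AddCommGroup (M ⟶ N) :=
  Function.Injective.addCommGroup (fun f => f.hom) (fun _ _ h => Mod.hom_ext _ _ h) rfl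
    (fun _ _ => rfl) (fun _ => rfl) (fun _ _ => rfl) (fun _ _ => rfl) (fun _ _ => rfl)

@[simp] lemma mod_add_hom {M N : Mod C A} (f g : M ⟶ N) : (f + g).hom = f.hom + g.hom := rfl

/-- `Rep A` is preadditive, with addition of morphisms as in `C`. -/
instance : Preadditive (Mod C A) where
  add_comp _ _ _ f f' g := by ext; simp
  comp_add _ _ _ f g g' := by ext; simp

end ModPreadditive

/-! ### The categories `Rep⁰ A`, `D` and `D⁰` -/

section Categories

variable {C : Type u} [Category.{v} C] [MonoidalCategory C] {A : C} [MonObj A]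
  {G : Type w} [Group G]

/-- The objects `X` of `Rep A` with `μ_X ∘ R_{XA} ∘ R_{AX} = μ_X`. -/
def isLocal [BraidedCategory C] (A : C) [MonObj A] : ObjectProperty (Mod C A) :=
  fun M => (β_ A M.X).hom ≫ (β_ M.X A).hom ≫ γ[A, M.X] = γ[A, M.X]

/-- The category `Rep⁰ A`. -/
abbrev Rep₀ [BraidedCategory C] (A : C) [MonObj A] := (isLocal A).FullSubcategory

/-- Objects of `D`: `A`-modules with a compatible action of `G` by morphisms of `C`. -/
structure EquivMod (π : G →* Aut (Mon.mk A)) where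
  M : Mod C A
  φ : G → (M.X ⟶ M.X)
  φ_smul : ∀ g, γ[A, M.X] ≫ φ g = (autHom π g ⊗ₘ φ g) ≫ γ[A, M.X]
  φ_mul : ∀ g h, φ (g * h) = φ h ≫ φ g
  φ_one : φ 1 = 𝟙 M.X

namespace EquivMod

variable {π : G →* Aut (Mon.mk A)}

/-- Morphisms of `D`: morphisms of `A`-modules that commute with `G`. -/
@[ext]
structure Hom (X Y : EquivMod π) where
  f : X.M ⟶ Y.M
  comm : ∀ g, X.φ g ≫ f.hom = f.hom ≫ Y.φ g

/-- The category `D`. -/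
instance : Category (EquivMod π) where
  Hom := Hom
  id X := ⟨𝟙 X.M, by simp⟩
  comp f g := ⟨f.f ≫ g.f, fun x => by
    simp only [Mod.comp_hom', ← Category.assoc, f.comm]
    simp only [Category.assoc, g.comm]⟩

@[ext] lemma hom_ext {X Y : EquivMod π} (f g : X ⟶ Y) (h : f.f = g.f) : f = g := Hom.ext h

@[simp] lemma comp_f {X Y Z : EquivMod π} (f : X ⟶ Y) (g : Y ⟶ Z) : (f ≫ g).f = f.f ≫ g.f := rfl
@[simp] lemma id_f (X : EquivMod π) : (𝟙 X : X ⟶ X).f = 𝟙 X.M := rfl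

variable [Preadditive C] [MonoidalPreadditive C]

instance (X Y : EquivMod π) : Zero (X ⟶ Y) := ⟨⟨0, fun g =>
  show X.φ g ≫ (0 : X.M.X ⟶ Y.M.X) = (0 : X.M.X ⟶ Y.M.X) ≫ Y.φ g by simp⟩⟩
instance (X Y : EquivMod π) : Add (X ⟶ Y) := ⟨fun a b => ⟨a.f + b.f, fun g =>
  show X.φ g ≫ (a.f.hom + b.f.hom) = (a.f.hom + b.f.hom) ≫ Y.φ g by simp [a.comm, b.comm]⟩⟩
instance (X Y : EquivMod π) : Neg (X ⟶ Y) := ⟨fun a => ⟨-a.f, fun g =>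
  show X.φ g ≫ (-a.f.hom) = (-a.f.hom) ≫ Y.φ g by simp [a.comm]⟩⟩
instance (X Y : EquivMod π) : Sub (X ⟶ Y) := ⟨fun a b => ⟨a.f - b.f, fun g =>
  show X.φ g ≫ (a.f.hom - b.f.hom) = (a.f.hom - b.f.hom) ≫ Y.φ g by simp [a.comm, b.comm]⟩⟩
instance (X Y : EquivMod π) : SMul ℕ (X ⟶ Y) := ⟨fun n a => ⟨n • a.f, fun g =>
  show X.φ g ≫ (n • a.f.hom) = (n • a.f.hom) ≫ Y.φ g by simp [a.comm]⟩⟩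
instance (X Y : EquivMod π) : SMul ℤ (X ⟶ Y) := ⟨fun n a => ⟨n • a.f, fun g =>
  show X.φ g ≫ (n • a.f.hom) = (n • a.f.hom) ≫ Y.φ g by simp [a.comm]⟩⟩

instance (X Y : EquivMod π) : AddCommGroup (X ⟶ Y) :=
  Function.Injective.addCommGroup (fun a => a.f) (fun _ _ h => hom_ext _ _ h) rfl
    (fun _ _ => rfl) (fun _ => rfl) (fun _ _ => rfl) (fun _ _ => rfl) (fun _ _ => rfl)

@[simp] lemma add_f {X Y : EquivMod π} (a b : X ⟶ Y) : (a + b).f = a.f + b.f := rfl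

/-- `D` is preadditive, with addition of morphisms as in `C`. -/
instance : Preadditive (EquivMod π) where
  add_comp _ _ _ f f' g := by ext1; simp
  comp_add _ _ _ f g g' := by ext1; simp

end EquivMod

/-- The objects of `D` whose underlying `A`-module lies in `Rep⁰ A`. -/
def isLocalEquiv [BraidedCategory C] (π : G →* Aut (Mon.mk A)) : ObjectProperty (EquivMod π) :=
  fun X => isLocal A X.M

/-- The category `D⁰`. -/
abbrev EquivMod₀ [BraidedCategory C] (π : G →* Aut (Mon.mk A)) :=
  (isLocalEquiv π).FullSubcategory

end Categories

/-! ### Actions of groups on categories and on isomorphism classes of simple objects -/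

section Actions

/-- An action of a group on a category by functors. -/
structure CatAction (G : Type w) [Group G] (E : Type u) [Category.{v} E] where
  F : G → E ⥤ E
  one : Nonempty (F 1 ≅ 𝟭 E)
  mul : ∀ g h, Nonempty (F (g * h) ≅ F h ⋙ F g)

variable {G : Type w} [Group G] {E : Type u} [Category.{v} E] [HasZeroMorphisms E]

/-- Isomorphism of simple objects. -/
def simpleSetoid (E : Type u) [Category.{v} E] [HasZeroMorphisms E] :
    Setoid {X : E // Simple X} where
  r X Y := Nonempty (X.1 ≅ Y.1)
  iseqv := ⟨fun _ => ⟨Iso.refl _⟩, fun ⟨e⟩ => ⟨e.symm⟩, fun ⟨e⟩ ⟨f⟩ => ⟨e ≪≫ f⟩⟩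

/-- The set of isomorphism classes of simple objects of a category on which `G` acts. -/
def SimpleClass (_T : CatAction G E) := Quotient (simpleSetoid E)

/-- The isomorphism class of a simple object. -/
def SimpleClass.mk (T : CatAction G E) (X : E) (h : Simple X) : SimpleClass T :=
  Quotient.mk (simpleSetoid E) ⟨X, h⟩

lemma SimpleClass.mk_eq_iff (T : CatAction G E) {X Y : E} (hX : Simple X) (hY : Simple Y) :
    SimpleClass.mk T X hX = SimpleClass.mk T Y hY ↔ Nonempty (X ≅ Y) :=
  Quotient.eq (r := simpleSetoid E)

/-- Each functor of the action is an equivalence. -/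
def CatAction.equiv (T : CatAction G E) (g : G) : E ≌ E :=
  CategoryTheory.Equivalence.mk (T.F g) (T.F g⁻¹)
    (T.one.some.symm ≪≫ eqToIso (by rw [inv_mul_cancel]) ≪≫ (T.mul g⁻¹ g).some)
    ((T.mul g g⁻¹).some.symm ≪≫ eqToIso (by rw [mul_inv_cancel]) ≪≫ T.one.some)

lemma simple_equiv {E' : Type u} [Category.{v} E'] [HasZeroMorphisms E'] (e : E' ≌ E) {X : E'}
    (hX : Simple X) : Simple (e.functor.obj X) := by
  refine ⟨fun {Y} f hf => ?_⟩
  let f' : e.inverse.obj Y ⟶ X := e.inverse.map f ≫ e.unitInv.app X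
  have hf' : Mono f' := mono_comp _ _
  have h1 : IsIso f' ↔ IsIso f := by
    constructor
    · intro h
      have : IsIso (e.inverse.map f) := by
        have : e.inverse.map f = f' ≫ e.unit.app X := by simp [f']
        rw [this]; infer_instance
      exact isIso_of_reflects_iso f e.inverse
    · intro h
      exact inferInstanceAs (IsIso (e.inverse.map f ≫ e.unitInv.app X))
  have h2 : f' = 0 ↔ f = 0 := by
    constructor
    · intro h
      have : e.inverse.map f = f' ≫ e.unit.app X := by simp [f']
      rw [h, zero_comp] at this
      apply e.inverse.map_injective
      rw [this, e.inverse.map_zero]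
    · intro h
      simp only [f', h, e.inverse.map_zero, zero_comp]
  rw [← h1, Simple.mono_isIso_iff_nonzero, Ne, h2]

lemma CatAction.simple (T : CatAction G E) (g : G) {X : E} (hX : Simple X) :
    Simple ((T.F g).obj X) :=
  simple_equiv (T.equiv g) hX

/-- The action `g • [X] = [F_g X]` of `G` on isomorphism classes of simple objects. -/
instance (T : CatAction G E) : MulAction G (SimpleClass T) where
  smul g := Quotient.map' (s₁ := simpleSetoid E) (s₂ := simpleSetoid E)
    (fun X => ⟨(T.F g).obj X.1, T.simple g X.2⟩) (fun _ _ ⟨e⟩ => ⟨(T.F g).mapIso e⟩)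
  one_smul x := by
    induction x using Quotient.ind with
    | _ X => exact Quotient.sound ⟨T.one.some.app X.1⟩
  mul_smul g h x := by
    induction x using Quotient.ind with
    | _ X => exact Quotient.sound ⟨(T.mul g h).some.app X.1⟩

lemma SimpleClass.smul_mk (T : CatAction G E) (g : G) {X : E} (hX : Simple X) :
    g • SimpleClass.mk T X hX = SimpleClass.mk T ((T.F g).obj X) (T.simple g hX) := rfl

instance {S : Type*} [MulAction G S] [Finite G] (O : MulAction.orbitRel.Quotient G S) :
    Finite O.orbit := by
  induction O using Quotient.ind with
  | _ s => exact Set.Finite.to_subtype (Set.finite_range (fun g : G => g • s))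

end Actions

section TwistAction

variable {C : Type u} [Category.{v} C] [MonoidalCategory C] {A : C} [MonObj A]
  {G : Type w} [Group G]

/-- The functor `Π_g : X ↦ X^{g⁻¹}`: the underlying object is `X`, and `A` acts through
`π_{g⁻¹}`. -/
def twistFunctor (π : G →* Aut (Mon.mk A)) (g : G) : Mod C A ⥤ Mod C A :=
  Mod.comap (autHom π g⁻¹)

/-- The action of `G` on `Rep A`. -/
def repAction (π : G →* Aut (Mon.mk A)) : CatAction G (Mod C A) where
  F := twistFunctor π
  one := ⟨NatIso.ofComponents (fun X =>
    { hom := Mod.Hom.mk' (𝟙 X.X) (by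
        change (autHom π 1⁻¹ ▷ X.X ≫ γ[A, X.X]) ≫ 𝟙 X.X = A ◁ 𝟙 X.X ≫ γ[A, X.X]
        simp [autHom_one])
      inv := Mod.Hom.mk' (𝟙 X.X) (by
        change γ[A, X.X] ≫ 𝟙 X.X = A ◁ 𝟙 X.X ≫ (autHom π 1⁻¹ ▷ X.X ≫ γ[A, X.X])
        simp [autHom_one])
      hom_inv_id := by apply Mod.hom_ext; exact Category.comp_id (𝟙 X.X)
      inv_hom_id := by apply Mod.hom_ext; exact Category.comp_id (𝟙 X.X) })
    (fun f => by
      apply Mod.hom_ext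
      exact (Category.comp_id f.hom).trans (Category.id_comp f.hom).symm)⟩
  mul g h := ⟨NatIso.ofComponents (fun X =>
    { hom := Mod.Hom.mk' (𝟙 X.X) (by
        change (autHom π (g * h)⁻¹ ▷ X.X ≫ γ[A, X.X]) ≫ 𝟙 X.X =
          A ◁ 𝟙 X.X ≫ autHom π g⁻¹ ▷ X.X ≫ autHom π h⁻¹ ▷ X.X ≫ γ[A, X.X]
        simp [autHom_mul])
      inv := Mod.Hom.mk' (𝟙 X.X) (by
        change (autHom π g⁻¹ ▷ X.X ≫ autHom π h⁻¹ ▷ X.X ≫ γ[A, X.X]) ≫ 𝟙 X.X =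
          A ◁ 𝟙 X.X ≫ autHom π (g * h)⁻¹ ▷ X.X ≫ γ[A, X.X]
        simp [autHom_mul])
      hom_inv_id := by apply Mod.hom_ext; exact Category.comp_id (𝟙 X.X)
      inv_hom_id := by apply Mod.hom_ext; exact Category.comp_id (𝟙 X.X) })
    (fun f => by
      apply Mod.hom_ext
      exact (Category.comp_id f.hom).trans (Category.id_comp f.hom).symm)⟩

variable [BraidedCategory C]

lemma isLocal_twist (π : G →* Aut (Mon.mk A)) (g : G) {X : Mod C A} (hX : isLocal A X) :
    isLocal A ((twistFunctor π g).obj X) := by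
  change (β_ A X.X).hom ≫ (β_ X.X A).hom ≫ autHom π g⁻¹ ▷ X.X ≫ γ[A, X.X] =
    autHom π g⁻¹ ▷ X.X ≫ γ[A, X.X]
  rw [← BraidedCategory.braiding_naturality_right_assoc,
    ← BraidedCategory.braiding_naturality_left_assoc]
  exact congrArg (autHom π g⁻¹ ▷ X.X ≫ ·) hX

/-- The action of `G` on `Rep⁰ A`. -/
def rep₀Action (π : G →* Aut (Mon.mk A)) : CatAction G (Rep₀ A) where
  F g := (isLocal A).lift ((isLocal A).ι ⋙ twistFunctor π g) (fun X => isLocal_twist π g X.2)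
  one := ⟨NatIso.ofComponents
    (fun X => (isLocal A).isoMk ((repAction π).one.some.app X.obj))
    (fun f => by ext1; exact (repAction π).one.some.hom.naturality f.hom)⟩
  mul g h := ⟨NatIso.ofComponents
    (fun X => (isLocal A).isoMk (((repAction π).mul g h).some.app X.obj))
    (fun f => by ext1; exact ((repAction π).mul g h).some.hom.naturality f.hom)⟩

end TwistAction

/-! ### Two-cocycles and twisted algebras -/

section TwistedAlgebra

variable {G : Type w} [Group G] {O : Type u} [MulAction G O]

/-- A 2-cocycle of `G` with values in the group `F*[O]` of non-vanishing functions on `O`, on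
which `G` acts by `(g • f) s = f (g⁻¹ • s)`. -/
@[ext]
structure TwoCocycle (G : Type w) [Group G] (O : Type u) [MulAction G O] where
  toFun : G → G → O → ℂˣ
  cocycle : ∀ g h k s,
    toFun g h s * toFun (g * h) k s = toFun h k (g⁻¹ • s) * toFun g (h * k) s

instance : CoeFun (TwoCocycle G O) (fun _ => G → G → O → ℂˣ) := ⟨TwoCocycle.toFun⟩

/-- The inverse cocycle. -/
instance : Inv (TwoCocycle G O) where
  inv α := ⟨fun g h s => (α g h s)⁻¹, fun g h k s => by
    rw [← mul_inv, α.cocycle, mul_inv]⟩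

@[simp] lemma TwoCocycle.inv_apply (α : TwoCocycle G O) (g h : G) (s : O) :
    α⁻¹ g h s = (α g h s)⁻¹ := rfl

lemma TwoCocycle.one_left (α : TwoCocycle G O) (k : G) (s : O) : α 1 k s = α 1 1 s := by
  have := α.cocycle 1 1 k s
  simp only [mul_one, one_mul, inv_one, one_smul] at this
  exact (mul_right_cancel this).symm

lemma TwoCocycle.one_right (α : TwoCocycle G O) (g : G) (s : O) :
    α g 1 s = α 1 1 (g⁻¹ • s) := by
  have := α.cocycle g 1 1 s
  simp only [mul_one] at this
  exact mul_right_cancel this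

/-- The twisted algebra `𝒜_α(G, O)`: the element `a` stands for `∑ g, a g * T_g` with
`a g ∈ F[O]`, and the product is determined by `T_g f = (g • f) T_g` for `f ∈ F[O]` and
`T_g T_h = α(g, h) T_{gh}`. -/
def TwistedAlg (_α : TwoCocycle G O) := G → O → ℂ

namespace TwistedAlg

variable {α : TwoCocycle G O}

instance : AddCommGroup (TwistedAlg α) := inferInstanceAs (AddCommGroup (G → O → ℂ))
instance : Module ℂ (TwistedAlg α) := inferInstanceAs (Module ℂ (G → O → ℂ))

@[ext] lemma ext {a b : TwistedAlg α} (h : ∀ g s, a g s = b g s) : a = b :=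
  funext fun g => funext fun s => h g s

@[simp] lemma add_apply (a b : TwistedAlg α) (g : G) (s : O) : (a + b) g s = a g s + b g s := rfl
@[simp] lemma zero_apply (g : G) (s : O) : (0 : TwistedAlg α) g s = 0 := rfl
@[simp] lemma smul_apply (c : ℂ) (a : TwistedAlg α) (g : G) (s : O) : (c • a) g s = c * a g s :=
  rfl

variable [Fintype G]

instance : Mul (TwistedAlg α) :=
  ⟨fun a b k s => ∑ g : G, a g s * b (g⁻¹ * k) (g⁻¹ • s) * (α g (g⁻¹ * k) s : ℂ)⟩

open Classical in
instance : One (TwistedAlg α) :=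
  ⟨fun g s => if g = 1 then ((α 1 1 s : ℂˣ) : ℂ)⁻¹ else 0⟩

lemma mul_apply (a b : TwistedAlg α) (k : G) (s : O) :
    (a * b) k s = ∑ g : G, a g s * b (g⁻¹ * k) (g⁻¹ • s) * (α g (g⁻¹ * k) s : ℂ) := rfl

open Classical in
lemma one_apply (g : G) (s : O) :
    (1 : TwistedAlg α) g s = if g = 1 then ((α 1 1 s : ℂˣ) : ℂ)⁻¹ else 0 := rfl

protected lemma mul_assoc' (a b c : TwistedAlg α) : a * b * c = a * (b * c) := by
  ext k s
  simp only [mul_apply, Finset.sum_mul, Finset.mul_sum]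
  rw [Finset.sum_comm]
  refine Finset.sum_congr rfl fun g _ => ?_
  refine (Fintype.sum_equiv (Equiv.mulLeft g) _ _ fun h => ?_).symm
  have hc := congrArg (fun x : ℂˣ => (x : ℂ)) (α.cocycle g h (h⁻¹ * g⁻¹ * k) s)
  simp only [Units.val_mul] at hc
  simp only [Equiv.coe_mulLeft, mul_inv_rev, inv_mul_cancel_left, mul_smul, mul_assoc] at hc ⊢
  simp only [mul_inv_cancel_left] at hc
  linear_combination (-(a g s * b h (g⁻¹ • s) * c (h⁻¹ * (g⁻¹ * k)) (h⁻¹ • g⁻¹ • s))) * hc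

instance : Ring (TwistedAlg α) where
  __ := (inferInstance : AddCommGroup (TwistedAlg α))
  mul_assoc := TwistedAlg.mul_assoc'
  one_mul a := by
    ext k s
    rw [mul_apply, Finset.sum_eq_single 1 (fun g _ hg => by simp [one_apply, hg]) (by simp)]
    simp [one_apply, α.one_left k s]
    field_simp
  mul_one a := by
    ext k s
    rw [mul_apply, Finset.sum_eq_single k
      (fun g _ hg => by
        have : g⁻¹ * k ≠ 1 := fun h => hg (inv_mul_eq_one.mp h)
        simp [one_apply, this]) (by simp)]
    simp [one_apply, α.one_right k s]
  zero_mul a := by ext k s; simp [mul_apply]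
  mul_zero a := by ext k s; simp [mul_apply]
  left_distrib a b c := by
    ext k s; simp [mul_apply, mul_add, add_mul, Finset.sum_add_distrib]
  right_distrib a b c := by
    ext k s; simp [mul_apply, add_mul, Finset.sum_add_distrib]

instance : Algebra ℂ (TwistedAlg α) :=
  Algebra.ofModule
    (fun c a b => by ext k s; simp [mul_apply, Finset.mul_sum, mul_assoc])
    (fun c a b => by
      ext k s
      simp only [mul_apply, smul_apply, Finset.mul_sum]
      exact Finset.sum_congr rfl fun _ _ => by ring)

variable (α) in
open Classical in
/-- The generator `T_g`. -/
def T (g : G) : TwistedAlg α := fun k _ => if k = g then 1 else 0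

variable (α) in
/-- The inclusion of functions `F[O]` into the twisted algebra, `f ↦ f · 1`. -/
def ofFun (f : O → ℂ) : TwistedAlg α := fun g s => f s * (1 : TwistedAlg α) g s

variable (α) in
open Classical in
/-- The idempotent given by the delta function at `s`. -/
def δ (s : O) : TwistedAlg α := ofFun α (fun t => if t = s then 1 else 0)

variable (α) in
open Classical in
/-- The basis element `δ_s T_g`. -/
def E (g : G) (s : O) : TwistedAlg α := fun k t => if k = g ∧ t = s then 1 else 0

lemma E_mul_E (g h : G) {s t : O} (hst : g • s = t) :
    E α g t * E α h s = ((α g h t : ℂˣ) : ℂ) • E α (g * h) t := by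
  ext k r
  rw [mul_apply, Finset.sum_eq_single g (fun g' _ hg => by simp [E, hg]) (by simp)]
  by_cases hr : r = t
  · subst hr
    have h1 : g⁻¹ • r = s := by rw [← hst, inv_smul_smul]
    by_cases hk : k = g * h
    · simp [E, hk, h1]
    · have : g⁻¹ * k ≠ h := fun e => hk (by rw [← e, mul_inv_cancel_left])
      simp [E, hk, this]
  · simp [E, hr]

lemma δ_eq (s : O) : δ α s = ((α 1 1 s : ℂˣ) : ℂ)⁻¹ • E α 1 s := by
  ext k r
  by_cases hk : k = 1 <;> by_cases hr : r = s <;> simp [δ, ofFun, one_apply, E, hk, hr]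

lemma E_mul_δ (g : G) {s t : O} (hst : g • s = t) : E α g t * δ α s = E α g t := by
  have : α g 1 t = α 1 1 s := by rw [α.one_right, ← hst, inv_smul_smul]
  rw [δ_eq, mul_smul_comm, E_mul_E g 1 hst, this, smul_smul, mul_one]
  simp

lemma δ_mul_E (g : G) (t : O) : δ α t * E α g t = E α g t := by
  rw [δ_eq, smul_mul_assoc, E_mul_E 1 g (one_smul G t), α.one_left g, smul_smul, one_mul]
  simp

lemma T_mul_δ (g : G) {s t : O} (hst : g • s = t) : T α g * δ α s = E α g t := by
  ext k r
  rw [mul_apply, Finset.sum_eq_single g (fun g' _ hg => by simp [T, hg]) (by simp)]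
  have e1 : g⁻¹ • r = s ↔ r = t := by rw [inv_smul_eq_iff, hst]
  have e2 : g⁻¹ * k = 1 ↔ k = g := by rw [inv_mul_eq_one, eq_comm]
  by_cases hk : k = g <;> by_cases hr : r = t
  · subst hk hr
    simp [T, δ, ofFun, one_apply, E, α.one_right, e1.mpr rfl]
  all_goals simp [T, δ, ofFun, one_apply, E, hk, hr, e1, e2]

end TwistedAlg

/-- A finite-dimensional representation of the twisted algebra. -/
structure TwistedRep [Fintype G] (α : TwoCocycle G O) where
  carrier : Type
  [addCommGroup : AddCommGroup carrier]
  [moduleℂ : Module ℂ carrier]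
  [module : Module (TwistedAlg α) carrier]
  [tower : IsScalarTower ℂ (TwistedAlg α) carrier]
  [finite : FiniteDimensional ℂ carrier]

namespace TwistedRep

variable [Fintype G] {α : TwoCocycle G O}

instance : CoeSort (TwistedRep α) Type := ⟨carrier⟩

attribute [instance] addCommGroup moduleℂ module tower finite

/-- Irreducible representations. -/
def IsIrreducible (V : TwistedRep α) : Prop := IsSimpleModule (TwistedAlg α) V

variable (V : TwistedRep α)

/-- The summand `V_s = δ_s V`. -/
def comp (s : O) : Submodule ℂ V :=
  LinearMap.range (Algebra.lsmul ℂ ℂ V (TwistedAlg.δ α s))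

lemma T_smul_eq (g : G) {s t : O} (h : g • s = t) {x : V} (hx : x ∈ V.comp s) :
    TwistedAlg.T α g • x = TwistedAlg.E α g t • x := by
  obtain ⟨y, rfl⟩ := hx
  change TwistedAlg.T α g • TwistedAlg.δ α s • y = TwistedAlg.E α g t • TwistedAlg.δ α s • y
  rw [← mul_smul, ← mul_smul, TwistedAlg.T_mul_δ g h, TwistedAlg.E_mul_δ g h]

lemma T_smul_mem (g : G) {s t : O} (h : g • s = t) {x : V} (hx : x ∈ V.comp s) :
    TwistedAlg.T α g • x ∈ V.comp t := by
  rw [V.T_smul_eq g h hx]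
  refine ⟨TwistedAlg.E α g t • x, ?_⟩
  change TwistedAlg.δ α t • TwistedAlg.E α g t • x = TwistedAlg.E α g t • x
  rw [← mul_smul, TwistedAlg.δ_mul_E]

/-- The map `V_s → V_t`, `t = g • s`, given by the action of `T_g`. -/
def act (g : G) {s t : O} (h : g • s = t) : V.comp s →ₗ[ℂ] V.comp t :=
  (Algebra.lsmul ℂ ℂ V (TwistedAlg.T α g)).restrict (fun _ hx => V.T_smul_mem g h hx)

lemma act_comp (g h : G) {s t r : O} (h1 : h • s = t) (h2 : g • t = r) (h3 : (g * h) • s = r) :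
    V.act g h2 ∘ₗ V.act h h1 = ((α g h r : ℂˣ) : ℂ) • V.act (g * h) h3 := by
  ext ⟨x, hx⟩
  change TwistedAlg.T α g • TwistedAlg.T α h • x =
    ((α g h r : ℂˣ) : ℂ) • TwistedAlg.T α (g * h) • x
  rw [V.T_smul_eq g h2 (V.T_smul_mem h h1 hx), V.T_smul_eq h h1 hx, V.T_smul_eq _ h3 hx,
    ← mul_smul, TwistedAlg.E_mul_E g h h2, smul_assoc]

lemma act_one {s : O} (h : (1 : G) • s = s) :
    V.act 1 h = ((α 1 1 s : ℂˣ) : ℂ) • LinearMap.id := by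
  ext ⟨x, hx⟩
  change TwistedAlg.T α 1 • x = ((α 1 1 s : ℂˣ) : ℂ) • x
  rw [V.T_smul_eq 1 h hx]
  obtain ⟨y, rfl⟩ := hx
  change TwistedAlg.E α 1 s • TwistedAlg.δ α s • y =
    ((α 1 1 s : ℂˣ) : ℂ) • TwistedAlg.δ α s • y
  rw [← mul_smul, TwistedAlg.E_mul_δ 1 h, TwistedAlg.δ_eq, ← smul_assoc, smul_smul]
  simp

end TwistedRep

end TwistedAlgebra

/-! ### Direct sums of modules, and the product `V ⊠ X` -/

section Sums

variable {C : Type u} [Category.{v} C] [MonoidalCategory C] [Preadditive C]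
  [MonoidalPreadditive C] [HasFiniteBiproducts C] {A : C} [MonObj A]

/-- The direct sum of a finite family of `A`-modules. -/
def directSum {J : Type*} [Finite J] (Y : J → Mod C A) : Mod C A :=
  letI : ModObj A (⨁ fun j => (Y j).X) :=
    { smul := biproduct.lift fun j =>
        A ◁ biproduct.π (fun j => (Y j).X) j ≫ γ[A, (Y j).X]
      one_smul := by
        refine biproduct.hom_ext _ _ fun j => ?_
        change (η[A] ▷ _ ≫ biproduct.lift _) ≫ _ = (λ_ _).hom ≫ _
        simp only [Category.assoc, biproduct.lift_π]
        rw [← whisker_exchange_assoc, ModObj.one_smul_self, leftUnitor_naturality]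
      mul_smul := by
        refine biproduct.hom_ext _ _ fun j => ?_
        change (μ[A] ▷ _ ≫ biproduct.lift _) ≫ _ =
          ((α_ A A _).hom ≫ A ◁ biproduct.lift _ ≫ biproduct.lift _) ≫ _
        simp only [Category.assoc, biproduct.lift_π]
        rw [← whisker_exchange_assoc, ModObj.mul_smul_self, ← whiskerLeft_comp_assoc,
          biproduct.lift_π]
        simp }
  ⟨⨁ fun j => (Y j).X⟩

/-- The projections of a direct sum, as morphisms of `C`. -/
def directSum.π {J : Type*} [Finite J] (Y : J → Mod C A) (j : J) : (directSum Y).X ⟶ (Y j).X :=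
  biproduct.π (fun j => (Y j).X) j

lemma directSum.smul_π {J : Type*} [Finite J] (Y : J → Mod C A) (j : J) :
    γ[A, (directSum Y).X] ≫ directSum.π Y j = A ◁ directSum.π Y j ≫ γ[A, (Y j).X] :=
  biproduct.lift_π _ _

lemma directSum.hom_ext {J : Type*} [Finite J] {Y : J → Mod C A} {Z : C}
    {f g : Z ⟶ (directSum Y).X} (h : ∀ j, f ≫ directSum.π Y j = g ≫ directSum.π Y j) : f = g :=
  biproduct.hom_ext _ _ h

/-- The morphism of `C` into a direct sum with given components. -/
def directSum.lift {J : Type*} [Finite J] {Y : J → Mod C A} {Z : C}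
    (f : ∀ j, Z ⟶ (Y j).X) : Z ⟶ (directSum Y).X :=
  biproduct.lift f

@[simp] lemma directSum.lift_π {J : Type*} [Finite J] {Y : J → Mod C A} {Z : C}
    (f : ∀ j, Z ⟶ (Y j).X) (j : J) : directSum.lift f ≫ directSum.π Y j = f j :=
  biproduct.lift_π _ _

lemma directSum.isLocal [BraidedCategory C] {J : Type*} [Finite J] {Y : J → Mod C A}
    (h : ∀ j, isLocal A (Y j)) : isLocal A (directSum Y) := by
  refine directSum.hom_ext fun j => ?_
  simp only [Category.assoc]
  rw [directSum.smul_π, ← BraidedCategory.braiding_naturality_left_assoc,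
    ← BraidedCategory.braiding_naturality_right_assoc]
  exact congrArg (A ◁ directSum.π Y j ≫ ·) (h j)

section Box

variable [Linear ℂ C]
variable (V V' V'' : Type*) [AddCommGroup V] [Module ℂ V] [FiniteDimensional ℂ V]
  [AddCommGroup V'] [Module ℂ V'] [FiniteDimensional ℂ V']
  [AddCommGroup V''] [Module ℂ V''] [FiniteDimensional ℂ V'']

/-- `V ⊠ X` for a finite-dimensional vector space `V` and an `A`-module `X`: a direct sum of
copies of `X`, indexed by a basis of `V`. -/
def box (X : Mod C A) : Mod C A := directSum fun _ : Fin (Module.finrank ℂ V) => X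

/-- The projection of `V ⊠ X` to the copy of `X` with index `i`. -/
def boxπ (X : Mod C A) (i : Fin (Module.finrank ℂ V)) : (box V X).X ⟶ X.X :=
  directSum.π (fun _ : Fin (Module.finrank ℂ V) => X) i

lemma box_smul_π (X : Mod C A) (i : Fin (Module.finrank ℂ V)) :
    γ[A, (box V X).X] ≫ boxπ V X i = A ◁ boxπ V X i ≫ γ[A, X.X] :=
  directSum.smul_π (fun _ : Fin (Module.finrank ℂ V) => X) i

variable {V V' V''}

lemma box_hom_ext {X : Mod C A} {Z : C} {f g : Z ⟶ (box V X).X}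
    (h : ∀ i, f ≫ boxπ V X i = g ≫ boxπ V X i) : f = g :=
  directSum.hom_ext h

/-- The morphism `L ⊠ f : V ⊠ X ⟶ V' ⊠ X'` of `C` given by a linear map `L` and a morphism `f`
of `C`: the matrix of `L` in the chosen bases, with entries multiplied by `f`. -/
def boxMap {X X' : Mod C A} (L : V →ₗ[ℂ] V') (f : X.X ⟶ X'.X) : (box V X).X ⟶ (box V' X').X :=
  directSum.lift fun j => ∑ i,
    ((Module.finBasis ℂ V').repr (L (Module.finBasis ℂ V i)) j) • (boxπ V X i ≫ f)

lemma boxMap_π {X X' : Mod C A} (L : V →ₗ[ℂ] V') (f : X.X ⟶ X'.X) (j) :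
    boxMap L f ≫ boxπ V' X' j = ∑ i,
      ((Module.finBasis ℂ V').repr (L (Module.finBasis ℂ V i)) j) • (boxπ V X i ≫ f) :=
  directSum.lift_π _ _

lemma boxMap_comp {X X' X'' : Mod C A} (L : V →ₗ[ℂ] V') (L' : V' →ₗ[ℂ] V'') (f : X.X ⟶ X'.X)
    (f' : X'.X ⟶ X''.X) : boxMap L f ≫ boxMap L' f' = boxMap (L' ∘ₗ L) (f ≫ f') := by
  refine box_hom_ext fun j => ?_
  have key : ∀ k, (Module.finBasis ℂ V'').repr (L' (L (Module.finBasis ℂ V k))) j =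
      ∑ i, (Module.finBasis ℂ V'').repr (L' (Module.finBasis ℂ V' i)) j *
        (Module.finBasis ℂ V').repr (L (Module.finBasis ℂ V k)) i := by
    intro k
    conv_lhs => rw [← (Module.finBasis ℂ V').sum_repr (L (Module.finBasis ℂ V k))]
    rw [map_sum, map_sum, Finsupp.finsetSum_apply]
    refine Finset.sum_congr rfl fun i _ => ?_
    rw [map_smul, map_smul, Finsupp.smul_apply, smul_eq_mul, mul_comm]
  rw [Category.assoc, boxMap_π, boxMap_π, Preadditive.comp_sum]
  simp only [Linear.comp_smul, LinearMap.comp_apply, key, Finset.sum_smul]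
  rw [Finset.sum_comm]
  refine Finset.sum_congr rfl fun i _ => ?_
  rw [← Category.assoc, boxMap_π, Preadditive.sum_comp, Finset.smul_sum]
  simp [smul_smul]

lemma boxMap_id (X : Mod C A) : boxMap (LinearMap.id : V →ₗ[ℂ] V) (𝟙 X.X) = 𝟙 (box V X).X := by
  refine box_hom_ext fun j => ?_
  rw [boxMap_π, Category.id_comp, Finset.sum_eq_single j]
  · simp
  · intro i _ hij
    simp [hij]
  · simp

lemma boxMap_smul_left {X X' : Mod C A} (c : ℂ) (L : V →ₗ[ℂ] V') (f : X.X ⟶ X'.X) :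
    boxMap (c • L) f = c • boxMap L f := by
  refine box_hom_ext fun j => ?_
  rw [boxMap_π, Linear.smul_comp, boxMap_π, Finset.smul_sum]
  simp [smul_smul]

lemma boxMap_smul_right {X X' : Mod C A} (c : ℂ) (L : V →ₗ[ℂ] V') (f : X.X ⟶ X'.X) :
    boxMap L (c • f) = c • boxMap L f := by
  refine box_hom_ext fun j => ?_
  rw [boxMap_π, Linear.smul_comp, boxMap_π, Finset.smul_sum]
  simp [smul_smul, mul_comm]

lemma boxMap_units {X X' : Mod C A} (c : ℂˣ) (L : V →ₗ[ℂ] V') (f : X.X ⟶ X'.X) :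
    boxMap (((c⁻¹ : ℂˣ) : ℂ) • L) ((c : ℂ) • f) = boxMap L f := by
  rw [boxMap_smul_left, boxMap_smul_right, smul_smul, ← Units.val_mul, inv_mul_cancel,
    Units.val_one, one_smul]

lemma boxMap_semilinear [MonoidalLinear ℂ C] {X X' : Mod C A} (L : V →ₗ[ℂ] V')
    (f : X.X ⟶ X'.X) (a : A ⟶ A) (h : γ[A, X.X] ≫ f = (a ⊗ₘ f) ≫ γ[A, X'.X]) :
    γ[A, (box V X).X] ≫ boxMap L f = (a ⊗ₘ boxMap L f) ≫ γ[A, (box V' X').X] := by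
  refine box_hom_ext fun j => ?_
  rw [Category.assoc, Category.assoc, box_smul_π, boxMap_π, MonoidalCategory.tensorHom_def,
    Category.assoc, ← whiskerLeft_comp_assoc, boxMap_π, Preadditive.comp_sum, whiskerLeft_sum,
    Preadditive.sum_comp, Preadditive.comp_sum]
  refine Finset.sum_congr rfl fun i _ => ?_
  rw [Linear.comp_smul, MonoidalLinear.whiskerLeft_smul, Linear.smul_comp, Linear.comp_smul,
    ← Category.assoc, box_smul_π, Category.assoc, h, MonoidalCategory.tensorHom_def]
  congr 1
  rw [MonoidalCategory.whiskerLeft_comp, Category.assoc, Category.assoc,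
    whisker_exchange_assoc]

end Box

end Sums

/-! ### Families of modules permuted by `G`, and the objects `X_{λ,O}` -/

section Families

variable {C : Type u} [Category.{v} C] [MonoidalCategory C] {A : C} [MonObj A]
  {G : Type w} [Group G]

/-- A family of `A`-modules `X_s`, indexed by a `G`-set `O`, with isomorphisms of `A`-modules
`φ_s(g) : X_s^{g⁻¹} ≅ X_{gs}`.  The index `t = g • s` of the target is an explicit variable. -/
structure TwistedFamily (π : G →* Aut (Mon.mk A)) (O : Type*) [MulAction G O] where
  X : O → Mod C A
  φ : ∀ (g : G) {s t : O}, g • s = t → ((twistFunctor π g).obj (X s) ≅ X t)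

namespace TwistedFamily

variable {π : G →* Aut (Mon.mk A)} {O : Type*} [MulAction G O] (R : TwistedFamily π O)

/-- `φ_s(g)` as a morphism `X_s ⟶ X_{gs}` of `C`. -/
def φC (g : G) {s t : O} (h : g • s = t) : (R.X s).X ⟶ (R.X t).X := (R.φ g h).hom.hom

lemma φC_semilinear (g : G) {s t : O} (h : g • s = t) :
    γ[A, (R.X s).X] ≫ R.φC g h = (autHom π g ⊗ₘ R.φC g h) ≫ γ[A, (R.X t).X] := by
  have h1 : (autHom π g⁻¹ ▷ (R.X s).X ≫ γ[A, (R.X s).X]) ≫ R.φC g h =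
    A ◁ R.φC g h ≫ γ[A, (R.X t).X] := (R.φ g h).hom.isModHom.smul_hom
  rw [MonoidalCategory.tensorHom_def, Category.assoc, ← h1, ← Category.assoc, ← Category.assoc,
    ← comp_whiskerRight, ← autHom_mul, inv_mul_cancel, autHom_one]
  simp

lemma φC_isIso (g : G) {s t : O} (h : g • s = t) : IsIso (R.φC g h) :=
  inferInstanceAs (IsIso ((Mod.forget A).map (R.φ g h).hom))

variable [Preadditive C] [Linear ℂ C]

/-- `α` is the cocycle of the projective action of `G` on `⨁ X_s`:
`φ(g) φ(h) = α(g, h) φ(gh)`, where the function `α(g, h)` on `O` acts on the summand `X_r` by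
its value at `r`. -/
def HasCocycle (α : TwoCocycle G O) : Prop :=
  ∀ (g h : G) {s t r : O} (h1 : h • s = t) (h2 : g • t = r) (h3 : (g * h) • s = r),
    R.φC h h1 ≫ R.φC g h2 = ((α g h r : ℂˣ) : ℂ) • R.φC (g * h) h3

variable {R} in
lemma HasCocycle.φC_one {α : TwoCocycle G O} (hα : R.HasCocycle α) {s : O}
    (h : (1 : G) • s = s) : R.φC 1 h = ((α 1 1 s : ℂˣ) : ℂ) • 𝟙 _ := by
  have := R.φC_isIso 1 h
  have key : ∀ (g : G) (e : g = 1) (h' : g • s = s),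
      R.φC 1 h ≫ R.φC 1 h = ((α 1 1 s : ℂˣ) : ℂ) • R.φC g h' →
      R.φC 1 h = ((α 1 1 s : ℂˣ) : ℂ) • 𝟙 _ := by
    rintro g rfl h' e
    rw [← cancel_mono (R.φC 1 h), e, Linear.smul_comp, Category.id_comp]
  exact key (1 * 1) (mul_one 1) (by rw [mul_one]; exact h) (hα 1 1 h h _)

variable [MonoidalPreadditive C] [HasFiniteBiproducts C] [MonoidalLinear ℂ C] [Fintype G]
  [Finite O]

/-- The `A`-module `⨁_s V_s ⊠ X_s`. -/
def sumMod {α : TwoCocycle G O} (V : TwistedRep α) : Mod C A :=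
  directSum fun s => box (V.comp s) (R.X s)

/-- The projection of `⨁_s V_s ⊠ X_s` to the summand of `s`. -/
def sumπ {α : TwoCocycle G O} (V : TwistedRep α) (s : O) :
    (R.sumMod V).X ⟶ (box (V.comp s) (R.X s)).X :=
  directSum.π (fun s => box (V.comp s) (R.X s)) s

lemma sum_smul_π {α : TwoCocycle G O} (V : TwistedRep α) (s : O) :
    γ[A, (R.sumMod V).X] ≫ R.sumπ V s =
      A ◁ R.sumπ V s ≫ γ[A, (box (V.comp s) (R.X s)).X] :=
  directSum.smul_π (fun s => box (V.comp s) (R.X s)) s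

lemma sum_hom_ext {α : TwoCocycle G O} {V : TwistedRep α} {Z : C}
    {f g : Z ⟶ (R.sumMod V).X} (h : ∀ s, f ≫ R.sumπ V s = g ≫ R.sumπ V s) : f = g :=
  directSum.hom_ext h

/-- The morphism `φ(g) = ⨁ φ_{V_s}(g) ⊗ φ_s(g)` of `⨁_s V_s ⊠ X_s`.  It maps the summand of
`s = g⁻¹ t` to the one of `t`. -/
def sumφ {α : TwoCocycle G O} (V : TwistedRep α) (g : G) :
    (R.sumMod V).X ⟶ (R.sumMod V).X :=
  directSum.lift fun t => R.sumπ V (g⁻¹ • t) ≫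
    boxMap (V.act g (smul_inv_smul g t)) (R.φC g (smul_inv_smul g t))

lemma sumφ_π {α : TwoCocycle G O} (V : TwistedRep α) (g : G) {s t : O} (h : g • s = t) :
    R.sumφ V g ≫ R.sumπ V t = R.sumπ V s ≫ boxMap (V.act g h) (R.φC g h) := by
  obtain rfl : s = g⁻¹ • t := by rw [← h, inv_smul_smul]
  exact directSum.lift_π _ _

/-- The object `X_{V,O} = ⨁_s V_s ⊠ X_s` of `D`, for a representation `V` of
`𝒜_{α⁻¹}(G, O)`. -/
def obj {α : TwoCocycle G O} (hα : R.HasCocycle α) (V : TwistedRep α⁻¹) : EquivMod π where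
  M := R.sumMod V
  φ := R.sumφ V
  φ_smul g := by
    refine R.sum_hom_ext fun t => ?_
    have e2 := R.sumφ_π V g (smul_inv_smul g t)
    rw [Category.assoc, Category.assoc, R.sum_smul_π, e2, ← Category.assoc, R.sum_smul_π,
      Category.assoc, boxMap_semilinear _ _ _ (R.φC_semilinear g _),
      MonoidalCategory.tensorHom_def, MonoidalCategory.tensorHom_def,
      Category.assoc, Category.assoc, ← whiskerLeft_comp_assoc, e2,
      MonoidalCategory.whiskerLeft_comp, Category.assoc, whisker_exchange_assoc]
  φ_mul g h := by
    refine R.sum_hom_ext fun r => ?_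
    have h2 : g • g⁻¹ • r = r := smul_inv_smul g r
    have h1 : h • h⁻¹ • g⁻¹ • r = g⁻¹ • r := smul_inv_smul h _
    have h3 : (g * h) • h⁻¹ • g⁻¹ • r = r := by rw [mul_smul, h1, h2]
    rw [Category.assoc, R.sumφ_π V g h2, R.sumφ_π V (g * h) h3, ← Category.assoc,
      R.sumφ_π V h h1, Category.assoc, boxMap_comp, V.act_comp g h h1 h2 h3, hα g h h1 h2 h3,
      TwoCocycle.inv_apply, boxMap_units]
  φ_one := by
    refine R.sum_hom_ext fun s => ?_
    rw [R.sumφ_π V 1 (one_smul G s), V.act_one, hα.φC_one, TwoCocycle.inv_apply,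
      boxMap_units, boxMap_id, Category.comp_id, Category.id_comp]

/-- The object `X_{V,O}` of `D⁰`, if all `X_s` lie in `Rep⁰ A`. -/
def obj₀ [BraidedCategory C] (hR : ∀ s, isLocal A (R.X s)) {α : TwoCocycle G O}
    (hα : R.HasCocycle α) (V : TwistedRep α⁻¹) : EquivMod₀ π :=
  ⟨R.obj hα V, directSum.isLocal fun s => directSum.isLocal fun _ => hR s⟩

end TwistedFamily

variable [Preadditive C] [MonoidalPreadditive C]

/-- A choice of representatives `X_s` of the classes `s` in an orbit `O` of `G` on the set of
isomorphism classes of simple objects of `Rep A`, and of isomorphisms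
`φ_s(g) : X_s^{g⁻¹} ≅ X_{gs}`. -/
structure OrbitReps (π : G →* Aut (Mon.mk A))
    (O : MulAction.orbitRel.Quotient G (SimpleClass (repAction π))) extends
    TwistedFamily π O.orbit where
  simple : ∀ s, Simple (X s)
  class_eq : ∀ s, SimpleClass.mk (repAction π) (X s) (simple s) = s.1

/-- The same for an orbit of `G` on the set of isomorphism classes of simple objects of
`Rep⁰ A`. -/
structure OrbitReps₀ [BraidedCategory C] (π : G →* Aut (Mon.mk A))
    (O : MulAction.orbitRel.Quotient G (SimpleClass (rep₀Action π))) extends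
    TwistedFamily π O.orbit where
  isLocal : ∀ s, isLocal A (X s)
  simple : ∀ s, Simple (⟨X s, isLocal s⟩ : Rep₀ A)
  class_eq : ∀ s, SimpleClass.mk (rep₀Action π) ⟨X s, isLocal s⟩ (simple s) = s.1

/-- Such choices exist. -/
theorem OrbitReps.nonempty (π : G →* Aut (Mon.mk A))
    (O : MulAction.orbitRel.Quotient G (SimpleClass (repAction π))) :
    Nonempty (OrbitReps π O) := by
  have hc : ∀ s : O.orbit, ∃ X : {X : Mod C A // Simple X},
      SimpleClass.mk (repAction π) X.1 X.2 = s.1 := fun s => Quotient.exists_rep s.1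
  choose X hX using hc
  have hφ : ∀ (g : G) (s t : O.orbit), g • s = t →
      Nonempty ((twistFunctor π g).obj (X s).1 ≅ (X t).1) := by
    intro g s t h
    have h' : g • s.1 = t.1 := congrArg Subtype.val h
    rw [← hX s, ← hX t, SimpleClass.smul_mk, SimpleClass.mk_eq_iff] at h'
    exact h'
  exact ⟨{ X := fun s => (X s).1
           φ := fun g {s t} h => (hφ g s t h).some
           simple := fun s => (X s).2
           class_eq := hX }⟩

theorem OrbitReps₀.nonempty [BraidedCategory C] (π : G →* Aut (Mon.mk A))
    (O : MulAction.orbitRel.Quotient G (SimpleClass (rep₀Action π))) :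
    Nonempty (OrbitReps₀ π O) := by
  have hc : ∀ s : O.orbit, ∃ X : {X : Rep₀ A // Simple X},
      SimpleClass.mk (rep₀Action π) X.1 X.2 = s.1 := fun s => Quotient.exists_rep s.1
  choose X hX using hc
  have hφ : ∀ (g : G) (s t : O.orbit), g • s = t →
      Nonempty ((twistFunctor π g).obj (X s).1.1 ≅ (X t).1.1) := by
    intro g s t h
    have h' : g • s.1 = t.1 := congrArg Subtype.val h
    rw [← hX s, ← hX t, SimpleClass.smul_mk, SimpleClass.mk_eq_iff] at h'
    exact ⟨(Orbifold.isLocal A).ι.mapIso h'.some⟩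
  exact ⟨{ X := fun s => (X s).1.1
           φ := fun g {s t} h => (hφ g s t h).some
           isLocal := fun s => (X s).1.2
           simple := fun s => (X s).2
           class_eq := hX }⟩

end Families

end

end Orbifold

/-! Semisimplicity is reduced to von Neumann regularity: every `f` has a `g` with `f ≫ g ≫ f = f`.
In a semisimple Hom-finite category this follows from Schur's lemma and McCoy's argument.
Conversely, a regular preadditive category with split idempotents and finite biproducts is abelian,
since kernels, cokernels, monos and epis all split. Each object is then a finite sum of simples once
some natural number drops along proper retracts; the dimension of the endomorphism algebra of the
underlying object of `C` does so.

Regularity climbs from `C` to `D` by two averagings. Non-degeneracy of the form on `A` gives a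
Casimir element `c` in `A ⊗ A`, and its product is `d` times the unit. Composing with the retraction
of the unit shows that `d` is `dim A`, because `A` is commutative with trivial twist; hence `d ≠ 0`.
Averaging a quasi-inverse against `c` makes it `A`-linear (`IsVonNeumannRegular.mod`), and averaging
over `G` makes it equivariant (`IsVonNeumannRegular.equivMod`). Full subcategories inherit
regularity. Locality passes to retracts, so an object of `D⁰` or `Rep⁰ A` is simple there exactly
when it is simple in `D` or `Rep A`.

For the classification, Schur's lemma says that `φ_s(gh)` and the composite of `φ_s(h)` and
`φ_{hs}(g)` differ by a scalar, which defines `α`; its cocycle identity is associativity of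
composition. The modules `X_s` are pairwise non-isomorphic, so morphisms `X_{V,O} ⟶ X_{V',O}` are
block diagonal with blocks given by linear maps `V_s → V'_s`, and equivariance makes these a
morphism of representations. Thus `V ↦ X_{V,O}` is fully faithful (`objMap_injective`,
`objMap_surjective`), which gives simplicity for irreducible `V` and the isomorphism criterion.
Objects from different orbits have no simple module in common, so they are not isomorphic.

For exhaustion, let `Y` be simple in `D`. Its module contains a simple module, whose orbit is `O`.
The spaces `Hom(X_s, Y)` carry operators `f ↦ φ_s(g)⁻¹ f φ_Y(g)`; the inverse turns `α` into `α⁻¹`,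
so they form a representation of the twisted algebra. An irreducible subrepresentation `V` gives a
nonzero evaluation map `X_{V,O} ⟶ Y` between simple objects, which is an isomorphism
(`exists_iso_obj`). -/

namespace Orbifold

/-! ### Von Neumann regular categories -/

section Regular

variable {E : Type u} [Category.{v} E] [Preadditive E]

/-- Every morphism of the category has a quasi-inverse. -/
def IsVonNeumannRegular (E : Type u) [Category.{v} E] : Prop :=
  ∀ (X Y : E) (f : X ⟶ Y), ∃ g : Y ⟶ X, f ≫ g ≫ f = f

lemma IsVonNeumannRegular.exists_retraction {E : Type u} [Category.{v} E]
    (h : IsVonNeumannRegular E) {X Y : E} (f : X ⟶ Y) [Mono f] : ∃ r : Y ⟶ X, f ≫ r = 𝟙 X := by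
  obtain ⟨g, hg⟩ := h _ _ f
  exact ⟨g, by rw [← cancel_mono f, Category.assoc, hg, Category.id_comp]⟩

lemma IsVonNeumannRegular.exists_section {E : Type u} [Category.{v} E]
    (h : IsVonNeumannRegular E) {X Y : E} (f : X ⟶ Y) [Epi f] : ∃ i : Y ⟶ X, i ≫ f = 𝟙 Y := by
  obtain ⟨g, hg⟩ := h _ _ f
  exact ⟨g, by rw [← cancel_epi f, hg, Category.comp_id]⟩

lemma IsVonNeumannRegular.fullSubcategory {E : Type u} [Category.{v} E]
    (h : IsVonNeumannRegular E) (P : ObjectProperty E) :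
    IsVonNeumannRegular P.FullSubcategory := by
  intro X Y f
  obtain ⟨g, hg⟩ := h _ _ f.hom
  exact ⟨ObjectProperty.homMk g, by ext1; exact hg⟩

/-- The complement of the image of `e`. It supplies kernels, cokernels and complementary summands.
-/
lemma split_id_sub [IsIdempotentComplete E] {X : E} (e : X ⟶ X) (he : e ≫ e = e) :
    ∃ (Z : E) (i : Z ⟶ X) (p : X ⟶ Z), i ≫ p = 𝟙 Z ∧ p ≫ i = 𝟙 X - e :=
  IsIdempotentComplete.idempotents_split X _ (Idempotents.idem_of_id_sub_idem e he)

/-- If `g` is a quasi-inverse, `f ≫ g` is an idempotent with the same kernel as `f`, so the kernel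
is the image of `𝟙 X - f ≫ g`. -/
lemma IsVonNeumannRegular.hasKernels [IsIdempotentComplete E] (h : IsVonNeumannRegular E) :
    HasKernels E where
  has_limit {X Y} f := by
    obtain ⟨g, hg⟩ := h _ _ f
    obtain ⟨Z, i, p, hip, hpi⟩ := split_id_sub (f ≫ g) (by simp [reassoc_of% hg])
    have w : i ≫ f = 0 := by
      have : i = i ≫ p ≫ i := by rw [← Category.assoc, hip, Category.id_comp]
      rw [this, hpi]
      simp [hg]
    have : Mono i := ⟨fun a b hab => by
      simpa [hip] using congrArg (· ≫ p) hab⟩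
    exact ⟨⟨_, KernelFork.IsLimit.ofι' i w fun k hk => ⟨k ≫ p, by
      rw [Category.assoc, hpi, Preadditive.comp_sub, ← Category.assoc, hk]; simp⟩⟩⟩

/-- Dually, the cokernel is the image of `𝟙 Y - g ≫ f`. -/
lemma IsVonNeumannRegular.hasCokernels [IsIdempotentComplete E] (h : IsVonNeumannRegular E) :
    HasCokernels E where
  has_colimit {X Y} f := by
    obtain ⟨g, hg⟩ := h _ _ f
    obtain ⟨Z, i, p, hip, hpi⟩ := split_id_sub (g ≫ f) (by rw [Category.assoc, hg])
    have w : f ≫ p = 0 := by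
      have : p = (p ≫ i) ≫ p := by rw [Category.assoc, hip, Category.comp_id]
      rw [this, hpi, ← Category.assoc, Preadditive.comp_sub, hg]
      simp
    have : Epi p := ⟨fun a b hab => by
      simpa [← Category.assoc, hip] using congrArg (i ≫ ·) hab⟩
    exact ⟨⟨_, CokernelCofork.IsColimit.ofπ' p w fun k hk => ⟨i ≫ k, by
      rw [← Category.assoc, hpi, Preadditive.sub_comp, Category.assoc, hk]; simp⟩⟩⟩

/-- Regular categories with finite products and split idempotents are abelian. -/
lemma IsVonNeumannRegular.isAbelianCat [IsIdempotentComplete E] [HasFiniteProducts E]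
    (h : IsVonNeumannRegular E) : IsAbelianCat E where
  hasFiniteProducts := inferInstance
  hasKernels := h.hasKernels
  hasCokernels := h.hasCokernels
  normalMono := ⟨fun {X Y} f _ => by
    -- A split mono is the kernel of its complementary idempotent.
    obtain ⟨r, hr⟩ := h.exists_retraction f
    exact ⟨{ Z := Y
             g := 𝟙 Y - r ≫ f
             w := by rw [Preadditive.comp_sub, ← Category.assoc, hr]; simp
             isLimit := KernelFork.IsLimit.ofι' f _ fun k hk => ⟨k ≫ r, by
              rw [Preadditive.comp_sub, Category.comp_id, sub_eq_zero] at hk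
              rw [Category.assoc, ← hk]⟩ }⟩⟩
  normalEpi := ⟨fun {X Y} f _ => by
    obtain ⟨r, hr⟩ := h.exists_section f
    exact ⟨{ W := X
             g := 𝟙 X - f ≫ r
             w := by rw [Preadditive.sub_comp, Category.assoc, hr]; simp
             isColimit := CokernelCofork.IsColimit.ofπ' f _ fun k hk => ⟨r ≫ k, by
              rw [Preadditive.sub_comp, Category.id_comp, sub_eq_zero] at hk
              rw [← Category.assoc, ← hk]⟩ }⟩⟩

/-- A natural number valued function that decreases along proper retracts. -/
def IsRetractLength (l : E → ℕ) : Prop :=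
  ∀ (X Y : E) (i : Y ⟶ X) (r : X ⟶ Y), i ≫ r = 𝟙 Y → r ≫ i ≠ 𝟙 X → l Y < l X

/-- Failure of simplicity is witnessed by a mono that is nonzero but not invertible, and regularity
splits it. -/
lemma IsVonNeumannRegular.exists_proper_retract (h : IsVonNeumannRegular E) {X : E}
    (h0 : 𝟙 X ≠ 0) (hX : ¬ Simple X) :
    ∃ (Y : E) (i : Y ⟶ X) (r : X ⟶ Y), i ≫ r = 𝟙 Y ∧ i ≠ 0 ∧ r ≫ i ≠ 𝟙 X := by
  by_contra! H
  refine hX ⟨fun {Y} f _ => ⟨fun hf e => h0 ?_, fun hf => ?_⟩⟩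
  · subst e
    rw [← IsIso.inv_hom_id (0 : Y ⟶ X), comp_zero]
  · obtain ⟨r, hr⟩ := h.exists_retraction f
    exact ⟨r, hr, H Y f r hr hf⟩

/-- Passing to proper retracts lowers `l`, so the descent stops, and it can only stop at a simple
object. -/
lemma IsVonNeumannRegular.exists_simple (h : IsVonNeumannRegular E) {l : E → ℕ}
    (hl : IsRetractLength l) (X : E) (h0 : 𝟙 X ≠ 0) :
    ∃ (S : E) (i : S ⟶ X) (r : X ⟶ S), Simple S ∧ i ≫ r = 𝟙 S := by
  induction hn : l X using Nat.strong_induction_on generalizing X with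
  | _ n ih =>
    by_cases hX : Simple X
    · exact ⟨X, 𝟙 X, 𝟙 X, hX, Category.comp_id _⟩
    · obtain ⟨Y, i, r, hir, hi, hri⟩ := h.exists_proper_retract h0 hX
      obtain ⟨S, j, q, hS, hjq⟩ := ih (l Y) (hn ▸ hl _ _ i r hir hri) Y
        (fun e => hi (by rw [← Category.id_comp i, e, zero_comp])) rfl
      exact ⟨S, j ≫ i, r ≫ q, hS, by
        rw [Category.assoc, ← Category.assoc i, hir, Category.id_comp, hjq]⟩

/-- A decomposition of `X` as a finite direct sum of simple objects. -/
structure SimpleDecomposition (X : E) where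
  J : Type
  [fintype : Fintype J]
  L : J → E
  ι : ∀ j, L j ⟶ X
  π : ∀ j, X ⟶ L j
  ι_π : ∀ j, ι j ≫ π j = 𝟙 _
  ι_π_ne : ∀ j k, j ≠ k → ι j ≫ π k = 0
  total : ∑ j, π j ≫ ι j = 𝟙 X
  simple : ∀ j, Simple (L j)

/-- Decompositions of two complementary retracts give a decomposition. -/
def SimpleDecomposition.add {X Y Z : E} (dY : SimpleDecomposition Y) (dZ : SimpleDecomposition Z)
    (i : Y ⟶ X) (r : X ⟶ Y) (j : Z ⟶ X) (q : X ⟶ Z) (hir : i ≫ r = 𝟙 Y) (hjq : j ≫ q = 𝟙 Z)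
    (hiq : i ≫ q = 0) (hjr : j ≫ r = 0) (ht : r ≫ i + q ≫ j = 𝟙 X) : SimpleDecomposition X where
  J := dY.J ⊕ dZ.J
  fintype := @instFintypeSum _ _ dY.fintype dZ.fintype
  L := Sum.elim dY.L dZ.L
  ι := fun | .inl k => dY.ι k ≫ i | .inr k => dZ.ι k ≫ j
  π := fun | .inl k => r ≫ dY.π k | .inr k => q ≫ dZ.π k
  ι_π := by
    rintro (k | k)
    · simp [reassoc_of% hir, dY.ι_π]
    · simp [reassoc_of% hjq, dZ.ι_π]
  ι_π_ne := by
    rintro (k | k) (m | m) hkm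
    · change (dY.ι k ≫ i) ≫ r ≫ dY.π m = 0
      simpa [reassoc_of% hir] using dY.ι_π_ne k m (fun e => hkm (by rw [e]))
    · change (dY.ι k ≫ i) ≫ q ≫ dZ.π m = 0
      simp [reassoc_of% hiq]
    · change (dZ.ι k ≫ j) ≫ r ≫ dY.π m = 0
      simp [reassoc_of% hjr]
    · change (dZ.ι k ≫ j) ≫ q ≫ dZ.π m = 0
      simpa [reassoc_of% hjq] using dZ.ι_π_ne k m (fun e => hkm (by rw [e]))
  total := by
    let := dY.fintype
    let := dZ.fintype
    have e1 : ∑ k, (r ≫ dY.π k) ≫ dY.ι k ≫ i = r ≫ i := by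
      have := congrArg (fun f => r ≫ f ≫ i) dY.total
      simpa [Preadditive.comp_sum, Preadditive.sum_comp] using this
    have e2 : ∑ k, (q ≫ dZ.π k) ≫ dZ.ι k ≫ j = q ≫ j := by
      have := congrArg (fun f => q ≫ f ≫ j) dZ.total
      simpa [Preadditive.comp_sum, Preadditive.sum_comp] using this
    rw [Fintype.sum_sum_type]
    exact (congrArg₂ (· + ·) e1 e2).trans ht
  simple := by
    rintro (k | k)
    · exact dY.simple k
    · exact dZ.simple k

/-- Induction on `l X`: a proper nonzero retract and its complement are both shorter than `X`. -/
lemma IsVonNeumannRegular.nonempty_decomposition [IsIdempotentComplete E]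
    (h : IsVonNeumannRegular E) {l : E → ℕ} (hl : IsRetractLength l) (X : E) :
    Nonempty (SimpleDecomposition X) := by
  induction hn : l X using Nat.strong_induction_on generalizing X with
  | _ n ih =>
    by_cases h0 : 𝟙 X = 0
    · exact ⟨{ J := Empty, L := Empty.elim, ι := fun j => j.elim, π := fun j => j.elim
               ι_π := fun j => j.elim, ι_π_ne := fun j => j.elim, total := by simp [h0]
               simple := fun j => j.elim }⟩
    by_cases hX : Simple X
    · exact ⟨{ J := Unit, L := fun _ => X, ι := fun _ => 𝟙 X, π := fun _ => 𝟙 X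
               ι_π := by simp, ι_π_ne := fun _ _ hj => (hj rfl).elim, total := by simp
               simple := fun _ => hX }⟩
    · obtain ⟨Y, i, r, hir, hi, hri⟩ := h.exists_proper_retract h0 hX
      have he : (r ≫ i) ≫ r ≫ i = r ≫ i := by simp [reassoc_of% hir]
      obtain ⟨Z, j, q, hjq, hqj⟩ := split_id_sub (r ≫ i) he
      have hjr : j ≫ r = 0 := by
        have : j ≫ r = j ≫ (q ≫ j) ≫ r := by simp [reassoc_of% hjq]
        rw [this, hqj]
        simp [hir]
      have hiq : i ≫ q = 0 := by
        have : i ≫ q = i ≫ (q ≫ j) ≫ q := by simp [hjq]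
        rw [this, hqj]
        simp [reassoc_of% hir]
      -- The complement `Z` is a proper retract because `i` is nonzero and is killed by `q`.
      have hq : q ≫ j ≠ 𝟙 X := by
        intro e
        apply hi
        rw [← Category.comp_id i, ← e, ← Category.assoc, hiq, zero_comp]
      obtain ⟨dY⟩ := ih (l Y) (hn ▸ hl _ _ i r hir hri) Y rfl
      obtain ⟨dZ⟩ := ih (l Z) (hn ▸ hl _ _ j q hjq hq) Z rfl
      exact ⟨dY.add dZ i r j q hir hjq hiq hjr (by rw [hqj]; abel)⟩

lemma IsVonNeumannRegular.isSemisimpleCat [IsIdempotentComplete E] [HasFiniteProducts E]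
    (h : IsVonNeumannRegular E) {l : E → ℕ} (hl : IsRetractLength l) : IsSemisimpleCat E where
  isAbelian := h.isAbelianCat
  decomp X := by
    obtain ⟨d⟩ := h.nonempty_decomposition hl X
    let := d.fintype
    let e := (Fintype.equivFin d.J).symm
    let b : Bicone (fun k => d.L (e k)) :=
      { pt := X
        π := fun k => d.π (e k)
        ι := fun k => d.ι (e k)
        ι_π := fun k m => by
          by_cases hkm : k = m
          · subst hkm
            simp [d.ι_π]
          · simp [hkm, d.ι_π_ne (e k) (e m) (fun H => hkm (e.injective H))] }
    refine ⟨_, _, b, ⟨isBilimitOfTotal b ?_⟩, fun k => d.simple _, ⟨Iso.refl X⟩⟩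
    rw [← d.total]
    exact Fintype.sum_equiv e _ _ fun _ => rfl

/-- A nonzero object whose nonzero endomorphisms are invertible is simple. -/
lemma IsVonNeumannRegular.simple_of_isIso_end (h : IsVonNeumannRegular E) {X : E}
    (h0 : 𝟙 X ≠ 0) (hX : ∀ f : X ⟶ X, f ≠ 0 → IsIso f) : Simple X := by
  by_contra H
  obtain ⟨Y, i, r, hir, hi, hri⟩ := h.exists_proper_retract h0 H
  have he : (r ≫ i) ≫ r ≫ i = r ≫ i := by simp [reassoc_of% hir]
  -- The idempotent of a proper nonzero retract is neither zero nor invertible, as an invertible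
  -- idempotent is the identity.
  by_cases e : r ≫ i = 0
  · apply hi
    have : i = i ≫ r ≫ i := by simp [reassoc_of% hir]
    rw [this, e, comp_zero]
  · have := hX _ e
    exact hri (by rw [← cancel_epi (r ≫ i), he, Category.comp_id])

lemma simple_retract_nonzero {X S : E} (i : S ⟶ X) (r : X ⟶ S) (hS : Simple S)
    (hir : i ≫ r = 𝟙 S) : i ≠ 0 := by
  rintro rfl
  exact id_nonzero S (by rw [← hir, zero_comp])

end Regular

/-! ### Semisimple categories are regular -/

section Semisimple

variable {C : Type u} [Category.{v} C] [Preadditive C]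

lemma IsSemisimpleCat.isIdempotentComplete (hC : IsSemisimpleCat C) :
    IsIdempotentComplete C := by
  have := hC.isAbelian.hasKernels
  exact (Idempotents.isIdempotentComplete_iff_idempotents_have_kernels C).mpr fun _ _ _ => inferInstance

/-- Some matrix entry of `f` between simple summands is nonzero, hence invertible by Schur's lemma.
Its inverse, extended by zero, is `g`. -/
lemma IsSemisimpleCat.exists_partial_inverse (hC : IsSemisimpleCat C) {X Y : C} (f : X ⟶ Y) (hf : f ≠ 0) :
    ∃ g : Y ⟶ X, g ≫ f ≫ g = g ∧ g ≫ f ≠ 0 := by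
  have := hC.isAbelian.hasKernels
  obtain ⟨n, L, b, ⟨hb⟩, hL, ⟨e⟩⟩ := hC.decomp X
  obtain ⟨m, L', b', ⟨hb'⟩, hL', ⟨e'⟩⟩ := hC.decomp Y
  have hnz : ∃ i j, b.ι i ≫ e.inv ≫ f ≫ e'.hom ≫ b'.π j ≠ 0 := by
    by_contra! H
    apply hf
    have h1 : e.inv ≫ f ≫ e'.hom = 0 :=
      hb.isColimit.hom_ext fun ⟨i⟩ => hb'.isLimit.hom_ext fun ⟨j⟩ => by simpa using H i j
    rw [← cancel_epi e.inv, ← cancel_mono e'.hom, Category.assoc, h1]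
    simp
  obtain ⟨i, j, hij⟩ := hnz
  have := hL i
  have := hL' j
  have := isIso_of_hom_simple hij
  obtain ⟨c, hc, hc'⟩ := this.out
  refine ⟨e'.hom ≫ b'.π j ≫ c ≫ b.ι i ≫ e.inv, ?_, fun h => ?_⟩
  · simp only [Category.assoc] at hc ⊢
    rw [reassoc_of% hc]
  · have h2 : b'.ι j ≫ e'.inv ≫ ((e'.hom ≫ b'.π j ≫ c ≫ b.ι i ≫ e.inv) ≫ f) ≫ e'.hom ≫
        b'.π j = 𝟙 _ := by
      simpa using hc'
    rw [h] at h2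
    exact id_nonzero (L' j) (by rw [← h2]; simp)

variable [Linear ℂ C] [∀ X Y : C, FiniteDimensional ℂ (X ⟶ Y)]

/-- By McCoy's lemma, it suffices to split off a nonzero part of `f` repeatedly. -/
lemma IsSemisimpleCat.isVonNeumannRegular (hC : IsSemisimpleCat C) :
    IsVonNeumannRegular C := by
  intro X Y f
  -- The induction is on the dimension of the right ideal `f ≫ End Y` inside `X ⟶ Y`.
  induction hn : Module.finrank ℂ (LinearMap.range (Linear.leftComp ℂ Y f)) using
    Nat.strong_induction_on generalizing f with
  | _ n ih =>
    by_cases hf : f = 0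
    · exact ⟨0, by simp [hf]⟩
    obtain ⟨g, hg, hgf⟩ := hC.exists_partial_inverse f hf
    have hlt : LinearMap.range (Linear.leftComp ℂ Y (f - f ≫ g ≫ f)) <
        LinearMap.range (Linear.leftComp ℂ Y f) := by
      refine lt_of_le_of_ne ?_ fun e => ?_
      · rintro _ ⟨u, rfl⟩
        exact ⟨u - g ≫ f ≫ u, by simp⟩
      -- The ideal shrinks strictly: `g` kills `f - f ≫ g ≫ f` from the left, but not `f`.
      · have : f ∈ LinearMap.range (Linear.leftComp ℂ Y (f - f ≫ g ≫ f)) :=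
          e ▸ ⟨𝟙 Y, by simp⟩
        obtain ⟨u, hu⟩ := this
        apply hgf
        rw [← hu]
        simp [reassoc_of% hg]
    obtain ⟨k, hk⟩ := ih _ (hn ▸ Submodule.finrank_lt_finrank_of_lt hlt) _ rfl
    -- McCoy's formula: `f` composed with either outer factor gives `f' = f - f ≫ g ≫ f`, so the
    -- second summand contributes `f' ≫ k ≫ f' = f'`.
    refine ⟨g + (𝟙 Y - g ≫ f) ≫ k ≫ (𝟙 X - f ≫ g), ?_⟩
    simp only [Preadditive.comp_sub, Preadditive.sub_comp, Preadditive.comp_add,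
      Preadditive.add_comp, Category.assoc, Category.comp_id, Category.id_comp] at hk ⊢
    rw [← sub_eq_zero] at hk ⊢
    rw [← hk]
    abel

/-- The dimension of the endomorphism algebra decreases along proper retracts. -/
lemma isRetractLength_finrank_end :
    IsRetractLength (fun X : C => Module.finrank ℂ (X ⟶ X)) := by
  intro X Y i r hir hri
  let F : (Y ⟶ Y) →ₗ[ℂ] (X ⟶ X) := Linear.leftComp ℂ X r ∘ₗ Linear.rightComp ℂ Y i
  have hF : ∀ u, F u = r ≫ u ≫ i := fun u => rfl
  have hinj : Function.Injective F := fun a b hab => by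
    rw [hF, hF] at hab
    simpa [hir, reassoc_of% hir] using congrArg (fun t => i ≫ t ≫ r) hab
  change Module.finrank ℂ (Y ⟶ Y) < Module.finrank ℂ (X ⟶ X)
  rw [← LinearMap.finrank_range_of_inj hinj]
  -- Everything in the range of `F` is fixed by the idempotent `r ≫ i` on the left, so the range
  -- contains `𝟙 X` only if this idempotent is the identity.
  refine Submodule.finrank_lt fun e => hri ?_
  obtain ⟨u, hu⟩ : 𝟙 X ∈ LinearMap.range F := e ▸ Submodule.mem_top
  rw [hF] at hu
  have h2 : r ≫ i ≫ 𝟙 X = 𝟙 X := by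
    rw [← hu]
    simp [reassoc_of% hir]
  rwa [Category.comp_id] at h2

end Semisimple

end Orbifold

namespace Orbifold

open scoped MonObj

noncomputable section

/-! ### Casimir elements and averaging -/

section Casimir

variable {C : Type u} [Category.{v} C] [MonoidalCategory C] {A : C} [MonObj A]

/-- If the form `e(ab)` is non-degenerate, then its copairing `c` satisfies
`(a ⊗ 1) c = c (1 ⊗ a)`. -/
lemma casimir_comm (p : ExactPairing A A) (e : A ⟶ 𝟙_ C) (hp : p.evaluation' = μ[A] ≫ e) :
    (ρ_ A).inv ≫ A ◁ p.coevaluation' ≫ (α_ A A A).inv ≫ μ[A] ▷ A =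
      (λ_ A).inv ≫ p.coevaluation' ▷ A ≫ (α_ A A A).hom ≫ A ◁ μ[A] := by
  -- The left side is the mate of `μ` for the self-duality of `A`. It remains to transpose the right
  -- side back, where the zigzag identity `hz` and associativity give `μ`.
  have h1 : tensorRightHomEquiv A A A A μ[A] =
    (ρ_ A).inv ≫ A ◁ p.coevaluation' ≫ (α_ A A A).inv ≫ μ[A] ▷ A := rfl
  rw [← h1, ← Equiv.eq_symm_apply]
  have hz : p.coevaluation' ▷ A ≫ (α_ A A A).hom ≫ A ◁ (μ[A] ≫ e) = (λ_ A).hom ≫ (ρ_ A).inv := by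
    rw [← hp]; exact p.evaluation_coevaluation'
  have h2 : ∀ f : A ⟶ A ⊗ A, (tensorRightHomEquiv A A A A).symm f =
      f ▷ A ≫ (α_ A A A).hom ≫ A ◁ p.evaluation' ≫ (ρ_ A).hom := fun f => rfl
  have hm : A ◁ μ[A] ▷ A ≫ A ◁ μ[A] = A ◁ (α_ A A A).hom ≫ A ◁ A ◁ μ[A] ≫ A ◁ μ[A] := by
    simp [← MonoidalCategory.whiskerLeft_comp]
  rw [h2, hp]
  calc μ[A] = μ[A] ≫ (λ_ A).inv ≫ (p.coevaluation' ▷ A ≫ (α_ A A A).hom ≫ A ◁ (μ[A] ≫ e)) ≫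
        (ρ_ A).hom := by rw [hz]; simp
    _ = (λ_ (A ⊗ A)).inv ≫ (𝟙_ C ◁ μ[A] ≫ p.coevaluation' ▷ A) ≫ (α_ A A A).hom ≫
        A ◁ (μ[A] ≫ e) ≫ (ρ_ A).hom := by simp
    _ = (λ_ A).inv ▷ A ≫ (p.coevaluation' ▷ A) ▷ A ≫ (α_ A A A).hom ▷ A ≫
        (α_ A (A ⊗ A) A).hom ≫ A ◁ ((α_ A A A).hom ≫ A ◁ μ[A] ≫ μ[A] ≫ e) ≫ (ρ_ A).hom := by
      rw [whisker_exchange]; simp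
    _ = _ := by simp [reassoc_of% hm]

variable [BraidedCategory C] [RigidCategory C]

/-- The pairing `p` identifies `A` with its dual by `φ`, carrying the copairing and pairing of `p`
to those of `Aᘁ`. The twist on `A` is trivial and commutativity absorbs the braiding. -/
lemma balancing_dim_eq [IsCommMonObj A] (θ : Balancing C) (hθ : θ.θ.hom.app A = 𝟙 A)
    (p : ExactPairing A A) (e : A ⟶ 𝟙_ C) (hp : p.evaluation' = μ[A] ≫ e) :
    θ.dim A = p.coevaluation' ≫ μ[A] ≫ e := by
  let φ : A ⟶ Aᘁ := @rightAdjointMate _ _ _ A A inferInstance ⟨A⟩ (𝟙 A)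
  have h1 : p.coevaluation' ≫ A ◁ φ = η_ A Aᘁ := by
    have := @coevaluation_comp_rightAdjointMate _ _ _ A A inferInstance ⟨A⟩ (𝟙 A)
    rw [id_whiskerRight, Category.comp_id] at this
    exact this
  have h2 : φ ▷ A ≫ ε_ A Aᘁ = μ[A] ≫ e := by
    have := @rightAdjointMate_comp_evaluation _ _ _ A A inferInstance ⟨A⟩ (𝟙 A)
    rw [MonoidalCategory.whiskerLeft_id, Category.id_comp] at this
    exact this.trans hp
  rw [Balancing.dim, hθ, ← h1]
  simp only [Functor.id_obj, id_whiskerRight, Category.id_comp, Category.assoc]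
  rw [BraidedCategory.braiding_naturality_right_assoc, h2, IsCommMonObj.mul_comm_assoc]

variable [Preadditive C] [Linear ℂ C]

/-- A rigid algebra has a Casimir element whose product is a nonzero multiple of the unit. -/
lemma IsRigidAlgebra.exists_casimir [IsCommMonObj A] {θ : Balancing C}
    (hA : IsRigidAlgebra θ A) (hθ : θ.θ.hom.app A = 𝟙 A) :
    ∃ (c : 𝟙_ C ⟶ A ⊗ A) (d : ℂ), d ≠ 0 ∧ c ≫ μ[A] = d • η[A] ∧
      (ρ_ A).inv ≫ A ◁ c ≫ (α_ A A A).inv ≫ μ[A] ▷ A =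
      (λ_ A).inv ≫ c ▷ A ≫ (α_ A A A).hom ≫ A ◁ μ[A] := by
  obtain ⟨e, he, p, hp⟩ := hA.nondegenerate
  have hdim := balancing_dim_eq θ hθ p e hp
  have hη : η[A] ≠ 0 := by
    intro h
    rw [h, zero_comp] at he
    exact hA.dim_ne_zero (by rw [← Category.comp_id (θ.dim A), ← he, comp_zero])
  -- Since `Hom(𝟙, A)` is a line, the product of the copairing is `d` times the unit. Applying `e`
  -- turns it into `dim A`, so `d = 0` is impossible.
  obtain ⟨d, hd⟩ := exists_smul_eq_of_finrank_eq_one hA.unique_unit hη (p.coevaluation' ≫ μ[A])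
  refine ⟨p.coevaluation', d, fun h => hA.dim_ne_zero ?_, hd.symm, casimir_comm p e hp⟩
  rw [hdim, ← Category.assoc, ← hd, h, zero_smul, zero_comp]

end Casimir

section Average

variable {C : Type u} [Category.{v} C] [MonoidalCategory C] {A : C} [MonObj A]

/-- The average `∑ cᵢ f(c'ᵢ m)` of a morphism `f`, where `c = ∑ cᵢ ⊗ c'ᵢ`. -/
def average (c : 𝟙_ C ⟶ A ⊗ A) {M N : Mod C A} (f : M.X ⟶ N.X) : M.X ⟶ N.X :=
  (λ_ M.X).inv ≫ c ▷ M.X ≫ (α_ A A M.X).hom ≫ A ◁ γ[A, M.X] ≫ A ◁ f ≫ γ[A, N.X]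

/-- Moving `a` across the Casimir tensor gives `∑ a cᵢ f(c'ᵢ m) = ∑ cᵢ f(c'ᵢ a m)`. The
associativity of the action is used on `M` in `hl` and on `N` in `hr`. -/
lemma average_linear {c : 𝟙_ C ⟶ A ⊗ A}
    (hc : (ρ_ A).inv ≫ A ◁ c ≫ (α_ A A A).inv ≫ μ[A] ▷ A =
      (λ_ A).inv ≫ c ▷ A ≫ (α_ A A A).hom ≫ A ◁ μ[A]) {M N : Mod C A} (f : M.X ⟶ N.X) :
    γ[A, M.X] ≫ average c f = A ◁ average c f ≫ γ[A, N.X] := by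
  have h := congrArg (fun t => t ▷ M.X ≫ (α_ A A M.X).hom ≫ A ◁ (γ[A, M.X] ≫ f) ≫ γ[A, N.X]) hc
  have hm : A ◁ μ[A] ▷ M.X ≫ A ◁ γ[A, M.X] =
      A ◁ (α_ A A M.X).hom ≫ A ◁ A ◁ γ[A, M.X] ≫ A ◁ γ[A, M.X] := by
    simp [← MonoidalCategory.whiskerLeft_comp]
  have hl : γ[A, M.X] ≫ average c f = ((λ_ A).inv ≫ c ▷ A ≫ (α_ A A A).hom ≫ A ◁ μ[A]) ▷ M.X ≫
      (α_ A A M.X).hom ≫ A ◁ (γ[A, M.X] ≫ f) ≫ γ[A, N.X] := by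
    calc _ = (λ_ (A ⊗ M.X)).inv ≫ (𝟙_ C ◁ γ[A, M.X] ≫ c ▷ M.X) ≫ (α_ A A M.X).hom ≫
          A ◁ γ[A, M.X] ≫ A ◁ f ≫ γ[A, N.X] := by simp [average]
      _ = (λ_ A).inv ▷ M.X ≫ (c ▷ A) ▷ M.X ≫ (α_ A A A).hom ▷ M.X ≫ (α_ A (A ⊗ A) M.X).hom ≫
          A ◁ ((α_ A A M.X).hom ≫ A ◁ γ[A, M.X] ≫ γ[A, M.X]) ≫ A ◁ f ≫ γ[A, N.X] := by
        rw [whisker_exchange]; simp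
      _ = _ := by simp [reassoc_of% hm]
  have hr : A ◁ average c f ≫ γ[A, N.X] = ((ρ_ A).inv ≫ A ◁ c ≫ (α_ A A A).inv ≫ μ[A] ▷ A) ▷ M.X ≫
      (α_ A A M.X).hom ≫ A ◁ (γ[A, M.X] ≫ f) ≫ γ[A, N.X] := by
    calc _ = (ρ_ A).inv ▷ M.X ≫ (A ◁ c) ▷ M.X ≫ (α_ A A A).inv ▷ M.X ≫ (α_ (A ⊗ A) A M.X).hom ≫
          (A ⊗ A) ◁ (γ[A, M.X] ≫ f) ≫ (α_ A A N.X).hom ≫ A ◁ γ[A, N.X] ≫ γ[A, N.X] := by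
            simp [average]
      _ = (ρ_ A).inv ▷ M.X ≫ (A ◁ c) ▷ M.X ≫ (α_ A A A).inv ▷ M.X ≫ (α_ (A ⊗ A) A M.X).hom ≫
          ((A ⊗ A) ◁ (γ[A, M.X] ≫ f) ≫ μ[A] ▷ N.X) ≫ γ[A, N.X] := by
            rw [← ModObj.mul_smul_self]; simp
      _ = _ := by
        rw [whisker_exchange]; simp
  rw [hl, hr, h]

lemma average_comp (c : 𝟙_ C ⟶ A ⊗ A) {M N P : Mod C A} (f : M.X ⟶ N.X) (g : N ⟶ P) :
    average c (f ≫ g.hom) = average c f ≫ g.hom := by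
  simp [average]

/-- With `average_comp`, this pulls both outer factors of `f ≫ g ≫ f` out of the average when `f` is
`A`-linear. -/
lemma comp_average (c : 𝟙_ C ⟶ A ⊗ A) {M N P : Mod C A} (f : M ⟶ N) (g : N.X ⟶ P.X) :
    average c (f.hom ≫ g) = f.hom ≫ average c g := by
  have h1 : f.hom ≫ (λ_ N.X).inv ≫ c ▷ N.X ≫ (α_ A A N.X).hom =
      (λ_ M.X).inv ≫ c ▷ M.X ≫ (α_ A A M.X).hom ≫ A ◁ A ◁ f.hom := by
    rw [← associator_naturality_right, ← whisker_exchange_assoc]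
    simp
  have h2 : A ◁ γ[A, M.X] ≫ A ◁ f.hom = A ◁ A ◁ f.hom ≫ A ◁ γ[A, N.X] := by
    have hf : γ[A, M.X] ≫ f.hom = A ◁ f.hom ≫ γ[A, N.X] := f.isModHom.smul_hom
    rw [← MonoidalCategory.whiskerLeft_comp, ← MonoidalCategory.whiskerLeft_comp, hf]
  simp only [average, MonoidalCategory.whiskerLeft_comp, Category.assoc]
  rw [reassoc_of% h1, reassoc_of% h2]

/-- A linear `f` leaves the sum, and what remains is the action of `∑ cᵢ c'ᵢ = d`. -/
lemma average_linear_eq [Preadditive C] [MonoidalPreadditive C] [Linear ℂ C] [MonoidalLinear ℂ C]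
    {c : 𝟙_ C ⟶ A ⊗ A} {d : ℂ} (hc : c ≫ μ[A] = d • η[A]) {M N : Mod C A} (f : M ⟶ N) :
    average c f.hom = d • f.hom := by
  have h1 : average c (𝟙 M.X) = d • 𝟙 M.X := by
    have : average c (𝟙 M.X) = (λ_ M.X).inv ≫ c ▷ M.X ≫ (α_ A A M.X).hom ≫ A ◁ γ[A, M.X] ≫
      γ[A, M.X] := by simp [average]
    rw [this, ← ModObj.mul_smul_self, ← comp_whiskerRight_assoc, hc, MonoidalLinear.smul_whiskerRight,
      Linear.smul_comp, ModObj.one_smul_self, Linear.comp_smul]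
    simp
  have := average_comp c (𝟙 M.X) f
  rw [Category.id_comp] at this
  rw [this, h1, Linear.smul_comp, Category.id_comp]

end Average

end

end Orbifold

namespace Orbifold

open scoped MonObj

set_option linter.unusedSectionVars false

noncomputable section

/-! ### Full subcategories of regular categories -/

section FullSubcategories

variable {E : Type u} [Category.{v} E] [Preadditive E]

lemma IsRetractLength.comp {E' : Type*} [Category* E'] {l : E → ℕ} (hl : IsRetractLength l)
    (F : E' ⥤ E) [F.Faithful] : IsRetractLength (fun X => l (F.obj X)) := by
  intro X Y i r hir hri
  refine hl _ _ (F.map i) (F.map r) (by rw [← F.map_comp, hir, F.map_id]) fun h => hri ?_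
  apply F.map_injective
  rw [F.map_comp, h, F.map_id]

/-- Simplicity in terms of retracts instead of monos. Retracts in a full subcategory are retracts in
the ambient category, while monos a priori need not remain monos. -/
lemma IsVonNeumannRegular.simple_iff (h : IsVonNeumannRegular E) (X : E) :
    Simple X ↔ 𝟙 X ≠ 0 ∧ ∀ (Y : E) (i : Y ⟶ X) (r : X ⟶ Y), i ≫ r = 𝟙 Y → i ≠ 0 →
      r ≫ i = 𝟙 X := by
  refine ⟨fun hX => ⟨id_nonzero X, fun Y i r hir hi => ?_⟩, fun ⟨h0, H⟩ => ?_⟩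
  · have : Mono i := mono_of_mono_fac hir
    have := isIso_of_mono_of_nonzero hi
    rw [← cancel_epi i, reassoc_of% hir, Category.comp_id]
  · by_contra hX
    obtain ⟨Y, i, r, hir, hi, hri⟩ := h.exists_proper_retract h0 hX
    exact hri (H Y i r hir hi)

variable (P : ObjectProperty E) [P.IsStableUnderRetracts]

instance [IsIdempotentComplete E] : IsIdempotentComplete P.FullSubcategory where
  idempotents_split X p hp := by
    obtain ⟨Y, i, e, hie, hei⟩ := IsIdempotentComplete.idempotents_split X.obj p.hom
      (congrArg (fun f => f.hom) hp)
    exact ⟨⟨Y, P.prop_of_retract ⟨i, e, hie⟩ X.2⟩, ObjectProperty.homMk i,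
      ObjectProperty.homMk e, by ext1; exact hie, by ext1; exact hei⟩

lemma IsVonNeumannRegular.simple_fullSubcategory_iff (h : IsVonNeumannRegular E)
    (X : P.FullSubcategory) : Simple X ↔ Simple X.obj := by
  rw [IsVonNeumannRegular.simple_iff (h.fullSubcategory P), h.simple_iff]
  have h0 : ∀ {Y Z : P.FullSubcategory} (f : Y ⟶ Z), f = 0 ↔ f.hom = 0 := fun f =>
    ⟨fun e => by rw [e]; rfl, fun e => by ext1; exact e⟩
  refine and_congr (not_congr (h0 _)) ⟨fun H Y i r hir hi => ?_, fun H Y i r hir hi => ?_⟩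
  · have := H ⟨Y, P.prop_of_retract ⟨i, r, hir⟩ X.2⟩ (ObjectProperty.homMk i)
      (ObjectProperty.homMk r) (by ext1; exact hir) (fun e => hi ((h0 _).mp e))
    exact congrArg (fun f => f.hom) this
  · ext1
    exact H Y.obj i.hom r.hom (congrArg (fun f => f.hom) hir) (fun e => hi ((h0 _).mpr e))

lemma hasFiniteBiproducts_of_total
    (h : ∀ (n : ℕ) (f : Fin n → E), ∃ b : Bicone f, ∑ j, b.π j ≫ b.ι j = 𝟙 b.pt) :
    HasFiniteBiproducts E where
  out n := ⟨fun f => by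
    obtain ⟨b, hb⟩ := h n f
    exact hasBiproduct_of_total b hb⟩

end FullSubcategories

/-! ### Modules and equivariant modules -/

section Linear

variable {C : Type u} [Category.{v} C] [MonoidalCategory C] [Preadditive C]
  [MonoidalPreadditive C] {A : C} [MonObj A] [Linear ℂ C] [MonoidalLinear ℂ C]

instance (M N : Mod C A) : SMul ℂ (M ⟶ N) :=
  ⟨fun c f => modHom (c • f.hom) (by
    rw [MonoidalLinear.whiskerLeft_smul, Linear.smul_comp, Linear.comp_smul, mod_smul_hom])⟩

@[simp] lemma mod_smul_hom' {M N : Mod C A} (c : ℂ) (f : M ⟶ N) : (c • f).hom = c • f.hom := rfl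

/-- The underlying morphism in `C`, as an additive map. -/
def modHomAddHom (M N : Mod C A) : (M ⟶ N) →+ (M.X ⟶ N.X) where
  toFun f := f.hom
  map_zero' := rfl
  map_add' _ _ := rfl

lemma modHomAddHom_injective (M N : Mod C A) : Function.Injective (modHomAddHom M N) :=
  fun _ _ h => Mod.hom_ext _ _ h

instance (M N : Mod C A) : Module ℂ (M ⟶ N) :=
  Function.Injective.module ℂ (modHomAddHom M N) (modHomAddHom_injective M N) fun _ _ => rfl

/-- `Rep A` is a linear category. -/
instance : Linear ℂ (Mod C A) where
  smul_comp _ _ _ c f g := by ext; simp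
  comp_smul _ _ _ f c g := by ext; simp

instance [∀ X Y : C, FiniteDimensional ℂ (X ⟶ Y)] (M N : Mod C A) :
    FiniteDimensional ℂ (M ⟶ N) :=
  FiniteDimensional.of_injective
    ({ modHomAddHom M N with map_smul' := fun _ _ => rfl } : (M ⟶ N) →ₗ[ℂ] (M.X ⟶ N.X))
    (modHomAddHom_injective M N)

end Linear

/-! ### Splitting of idempotents in `Rep A` and in `D` -/

section Retracts

variable {C : Type u} [Category.{v} C] [MonoidalCategory C] {A : C} [MonObj A]

/-- The module structure on the image of an idempotent endomorphism `p ≫ i` of a module. -/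
def retractMod (M : Mod C A) {Z : C} (i : Z ⟶ M.X) (p : M.X ⟶ Z) (hip : i ≫ p = 𝟙 Z)
    (h : γ[A, M.X] ≫ p ≫ i = A ◁ (p ≫ i) ≫ γ[A, M.X]) : Mod C A :=
  letI : ModObj A Z :=
    { smul := A ◁ i ≫ γ[A, M.X] ≫ p
      one_smul := by
        change η[A] ▷ Z ≫ A ◁ i ≫ γ[A, M.X] ≫ p = (λ_ Z).hom
        rw [← whisker_exchange_assoc, ModObj.one_smul_self_assoc, leftUnitor_naturality_assoc, hip,
          Category.comp_id]
      mul_smul := by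
        change μ[A] ▷ Z ≫ A ◁ i ≫ γ[A, M.X] ≫ p =
          (α_ A A Z).hom ≫ A ◁ (A ◁ i ≫ γ[A, M.X] ≫ p) ≫ A ◁ i ≫ γ[A, M.X] ≫ p
        have h' : A ◁ p ≫ A ◁ i ≫ γ[A, M.X] ≫ p = γ[A, M.X] ≫ p := by
          rw [← MonoidalCategory.whiskerLeft_comp_assoc, ← reassoc_of% h, hip, Category.comp_id]
        rw [← whisker_exchange_assoc, ModObj.mul_smul_self_assoc,
          MonoidalCategory.whiskerLeft_comp, MonoidalCategory.whiskerLeft_comp, Category.assoc,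
          Category.assoc, h']
        simp }
  ⟨Z⟩

variable {M : Mod C A} {Z : C} {i : Z ⟶ M.X} {p : M.X ⟶ Z} {hip : i ≫ p = 𝟙 Z}
  {h : γ[A, M.X] ≫ p ≫ i = A ◁ (p ≫ i) ≫ γ[A, M.X]}

lemma retractMod_smul_i :
    γ[A, (retractMod M i p hip h).X] ≫ i = A ◁ i ≫ γ[A, M.X] := by
  have key : (A ◁ i ≫ γ[A, M.X] ≫ p) ≫ i = A ◁ i ≫ γ[A, M.X] := by
    rw [Category.assoc, Category.assoc, h, ← MonoidalCategory.whiskerLeft_comp_assoc,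
      reassoc_of% hip]
  exact key

lemma retractMod_smul_p :
    γ[A, M.X] ≫ p = A ◁ p ≫ γ[A, (retractMod M i p hip h).X] := by
  have key : γ[A, M.X] ≫ p = A ◁ p ≫ A ◁ i ≫ γ[A, M.X] ≫ p := by
    rw [← MonoidalCategory.whiskerLeft_comp_assoc, ← reassoc_of% h, hip, Category.comp_id]
  exact key

lemma autHom_comp_inv {G : Type w} [Group G] (π : G →* Aut (Mon.mk A)) (g : G) :
    autHom π g ≫ autHom π g⁻¹ = 𝟙 A := by
  rw [← autHom_mul, inv_mul_cancel, autHom_one]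

end Retracts

section Forget

variable {C : Type u} [Category.{v} C] [MonoidalCategory C] {A : C} [MonObj A]
  {G : Type w} [Group G] (π : G →* Aut (Mon.mk A))

/-- The functor from `D` to `Rep A` forgetting the action of `G`. -/
def EquivMod.forget : EquivMod π ⥤ Mod C A where
  obj X := X.M
  map f := f.f

instance : (EquivMod.forget π).Faithful where
  map_injective h := EquivMod.hom_ext _ _ h

instance : (Mod.forget A : Mod C A ⥤ C).Faithful where
  map_injective h := Mod.hom_ext _ _ h

end Forget

section IdempotentComplete

variable {C : Type u} [Category.{v} C] [MonoidalCategory C] [Preadditive C]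
  [MonoidalPreadditive C] {A : C} [MonObj A] {G : Type w} [Group G]

instance [IsIdempotentComplete C] : IsIdempotentComplete (Mod C A) where
  idempotents_split M e he := by
    obtain ⟨Z, i, p, hip, hpi⟩ := IsIdempotentComplete.idempotents_split M.X e.hom
      (congrArg (fun f => f.hom) he)
    have h : γ[A, M.X] ≫ p ≫ i = A ◁ (p ≫ i) ≫ γ[A, M.X] := by rw [hpi, mod_smul_hom]
    exact ⟨retractMod M i p hip h, modHom i retractMod_smul_i, modHom p retractMod_smul_p,
      Mod.hom_ext _ _ hip, Mod.hom_ext _ _ hpi⟩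

instance [IsIdempotentComplete C] (π : G →* Aut (Mon.mk A)) :
    IsIdempotentComplete (EquivMod π) where
  idempotents_split X e he := by
    obtain ⟨Z, i, p, hip, hpi⟩ := IsIdempotentComplete.idempotents_split X.M e.f
      (congrArg (fun f => f.f) he)
    have hip' : i.hom ≫ p.hom = 𝟙 Z.X := congrArg (fun f => f.hom) hip
    have hpi' : p.hom ≫ i.hom = e.f.hom := congrArg (fun f => f.hom) hpi
    -- The idempotent commutes with `G`, so compressing the action to its image keeps it
    -- multiplicative.
    have hpg : ∀ g, p.hom ≫ i.hom ≫ X.φ g = X.φ g ≫ p.hom ≫ i.hom := fun g => by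
      rw [← Category.assoc, hpi', e.comm]
    let Y : EquivMod π :=
      { M := Z
        φ := fun g => i.hom ≫ X.φ g ≫ p.hom
        φ_smul := fun g => by
          rw [← Category.assoc, mod_smul_hom, Category.assoc, reassoc_of% (X.φ_smul g),
            mod_smul_hom]
          simp [MonoidalCategory.tensorHom_def, whisker_exchange_assoc]
        φ_mul := fun g h => by
          simp only [X.φ_mul, Category.assoc]
          rw [reassoc_of% (hpg g), hip', Category.comp_id]
        φ_one := by rw [X.φ_one, Category.id_comp, hip'] }
    refine ⟨Y, ⟨i, fun g => ?_⟩, ⟨p, fun g => ?_⟩, ?_, ?_⟩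
    · change (i.hom ≫ X.φ g ≫ p.hom) ≫ i.hom = i.hom ≫ X.φ g
      rw [Category.assoc, Category.assoc, ← hpg, reassoc_of% hip']
    · change X.φ g ≫ p.hom = p.hom ≫ i.hom ≫ X.φ g ≫ p.hom
      rw [reassoc_of% (hpg g), hip', Category.comp_id]
    · ext1; exact hip
    · ext1; exact hpi

end IdempotentComplete

/-! ### Locality passes to retracts -/

section Local

variable {C : Type u} [Category.{v} C] [MonoidalCategory C] [BraidedCategory C] {A : C}
  [MonObj A] {G : Type w} [Group G]

/-- The double braiding is natural, so the identity for `N` pulls back along the inclusion `M ⟶ N`,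
which is mono in `C`. -/
instance : (isLocal A).IsStableUnderRetracts where
  of_retract {M N} r hN := by
    have hr : γ[A, M.X] ≫ r.i.hom = A ◁ r.i.hom ≫ γ[A, N.X] := r.i.isModHom.smul_hom
    have hir : r.i.hom ≫ r.r.hom = 𝟙 M.X := congrArg (fun f => f.hom) r.retract
    have : Mono r.i.hom := mono_of_mono_fac hir
    change (β_ A M.X).hom ≫ (β_ M.X A).hom ≫ γ[A, M.X] = γ[A, M.X]
    rw [← cancel_mono r.i.hom]
    simp only [Category.assoc]
    rw [hr, ← BraidedCategory.braiding_naturality_left_assoc,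
      ← BraidedCategory.braiding_naturality_right_assoc]
    exact congrArg (A ◁ r.i.hom ≫ ·) hN

instance (π : G →* Aut (Mon.mk A)) : (isLocalEquiv π).IsStableUnderRetracts where
  of_retract r hN := (isLocal A).prop_of_retract (r.map (EquivMod.forget π)) hN

end Local

/-! ### Finite direct sums in `D` and `D⁰` -/

section Biproducts

variable {C : Type u} [Category.{v} C] [MonoidalCategory C] [Preadditive C]
  [MonoidalPreadditive C] [HasFiniteBiproducts C] {A : C} [MonObj A] {G : Type w} [Group G]

/-- The injections of a direct sum, as morphisms of `C`. -/
def directSum.ι {J : Type*} [Finite J] (Y : J → Mod C A) (j : J) : (Y j).X ⟶ (directSum Y).X :=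
  biproduct.ι (fun j => (Y j).X) j

lemma directSum.ι_π_self {J : Type*} [Finite J] (Y : J → Mod C A) (j : J) :
    directSum.ι Y j ≫ directSum.π Y j = 𝟙 _ :=
  biproduct.ι_π_self _ _

lemma directSum.ι_π_ne {J : Type*} [Finite J] (Y : J → Mod C A) {j k : J} (h : j ≠ k) :
    directSum.ι Y j ≫ directSum.π Y k = 0 :=
  biproduct.ι_π_ne _ h

lemma directSum.total {J : Type*} [Fintype J] (Y : J → Mod C A) :
    ∑ j, directSum.π Y j ≫ directSum.ι Y j = 𝟙 (directSum Y).X :=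
  IsBilimit.total (biproduct.isBilimit fun j => (Y j).X)

lemma directSum.smul_ι {J : Type*} [Finite J] (Y : J → Mod C A) (j : J) :
    γ[A, (Y j).X] ≫ directSum.ι Y j = A ◁ directSum.ι Y j ≫ γ[A, (directSum Y).X] := by
  refine directSum.hom_ext fun k => ?_
  rw [Category.assoc, Category.assoc, directSum.smul_π, ← whiskerLeft_comp_assoc]
  by_cases h : j = k
  · subst h
    rw [directSum.ι_π_self]
    simp
  · rw [directSum.ι_π_ne Y h]
    simp

lemma directSum.hom_ext' {J : Type*} [Finite J] {Y : J → Mod C A} {Z : C}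
    {f g : (directSum Y).X ⟶ Z} (h : ∀ j, directSum.ι Y j ≫ f = directSum.ι Y j ≫ g) : f = g :=
  biproduct.hom_ext' _ _ h

/-- The direct sum of a finite family of objects of `D`. -/
def EquivMod.directSum {π : G →* Aut (Mon.mk A)} {J : Type*} [Finite J] (Y : J → EquivMod π) :
    EquivMod π where
  M := Orbifold.directSum fun j => (Y j).M
  φ g := directSum.lift fun j => directSum.π (fun j => (Y j).M) j ≫ (Y j).φ g
  φ_smul g := by
    refine directSum.hom_ext fun j => ?_
    simp only [Category.assoc, directSum.lift_π, directSum.smul_π]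
    rw [reassoc_of% (directSum.smul_π (fun j => (Y j).M) j), (Y j).φ_smul]
    simp only [MonoidalCategory.tensorHom_def, Category.assoc]
    rw [← whiskerLeft_comp_assoc, directSum.lift_π, MonoidalCategory.whiskerLeft_comp,
      Category.assoc, whisker_exchange_assoc]
  φ_mul g h := by
    refine directSum.hom_ext fun j => ?_
    have h1 : ∀ x, (directSum.lift fun j => directSum.π (fun j => (Y j).M) j ≫ (Y j).φ x) ≫
      directSum.π (fun j => (Y j).M) j = directSum.π (fun j => (Y j).M) j ≫ (Y j).φ x :=
        fun x => directSum.lift_π _ _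
    rw [h1, Category.assoc, h1, reassoc_of% (h1 h), (Y j).φ_mul]
  φ_one := by
    refine directSum.hom_ext fun j => ?_
    rw [directSum.lift_π, (Y j).φ_one, Category.comp_id, Category.id_comp]

/-- The direct sum of a finite family of objects of `D`, with its projections and injections. -/
def EquivMod.bicone {π : G →* Aut (Mon.mk A)} {n : ℕ} (Y : Fin n → EquivMod π) : Bicone Y :=
  ⟨EquivMod.directSum Y,
  fun j => ⟨modHom (directSum.π (fun j => (Y j).M) j) (directSum.smul_π _ _), fun g =>
    directSum.lift_π _ _⟩,
  fun j => ⟨modHom (directSum.ι (fun j => (Y j).M) j)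
      (directSum.smul_ι (fun j => (Y j).M) j), fun g => by
    refine directSum.hom_ext (Y := fun j => (Y j).M) fun k => ?_
    have h1 : (EquivMod.directSum Y).φ g ≫ directSum.π (fun j => (Y j).M) k =
      directSum.π (fun j => (Y j).M) k ≫ (Y k).φ g := directSum.lift_π _ _
    change ((Y j).φ g ≫ directSum.ι (fun j => (Y j).M) j) ≫ directSum.π (fun j => (Y j).M) k =
      (directSum.ι (fun j => (Y j).M) j ≫ (EquivMod.directSum Y).φ g) ≫
        directSum.π (fun j => (Y j).M) k
    refine (Category.assoc _ _ _).trans (Eq.trans ?_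
      ((congrArg (directSum.ι (fun j => (Y j).M) j ≫ ·) h1).symm.trans (Category.assoc _ _ _).symm))
    by_cases h : j = k
    · subst h
      rw [reassoc_of% (directSum.ι_π_self (fun j => (Y j).M) j), directSum.ι_π_self]
      simp
    · rw [directSum.ι_π_ne _ h, reassoc_of% (directSum.ι_π_ne (fun j => (Y j).M) h)]
      simp⟩,
  fun j k => by
    by_cases h : j = k
    · subst h
      simp only [dite_true, eqToHom_refl]
      ext1
      exact Mod.hom_ext _ _ (directSum.ι_π_self (fun j => (Y j).M) j)
    · simp only [h, dite_false]
      ext1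
      exact Mod.hom_ext _ _ (directSum.ι_π_ne (fun j => (Y j).M) h)⟩

/-- The underlying morphism in `C`, as an additive map. -/
def EquivMod.homAddHom {π : G →* Aut (Mon.mk A)} (X Y : EquivMod π) :
    (X ⟶ Y) →+ (X.M.X ⟶ Y.M.X) where
  toFun f := f.f.hom
  map_zero' := rfl
  map_add' _ _ := rfl

lemma EquivMod.bicone_total {π : G →* Aut (Mon.mk A)} {n : ℕ} (Y : Fin n → EquivMod π) :
    ∑ j, (bicone Y).π j ≫ (bicone Y).ι j = 𝟙 (bicone Y).pt := by
  ext1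
  apply Mod.hom_ext
  change homAddHom _ _ _ = _
  rw [map_sum]
  exact directSum.total fun j => (Y j).M

instance (π : G →* Aut (Mon.mk A)) : HasFiniteBiproducts (EquivMod π) :=
  hasFiniteBiproducts_of_total fun _ Y => ⟨_, EquivMod.bicone_total Y⟩

instance [BraidedCategory C] (π : G →* Aut (Mon.mk A)) : HasFiniteBiproducts (EquivMod₀ π) :=
  hasFiniteBiproducts_of_total fun n Y => by
    let b := EquivMod.bicone fun j => (Y j).obj
    refine ⟨⟨⟨b.pt, directSum.isLocal fun j => (Y j).2⟩, fun j => ObjectProperty.homMk (b.π j),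
      fun j => ObjectProperty.homMk (b.ι j), fun j k => ?_⟩, ?_⟩
    · by_cases h : j = k
      · subst h
        simp only [dite_true, eqToHom_refl]
        ext1
        exact bicone_ι_π_self b j
      · simp only [h, dite_false]
        ext1
        exact bicone_ι_π_ne b h
    · apply (isLocalEquiv π).ι.map_injective
      rw [Functor.map_sum]
      exact EquivMod.bicone_total _

end Biproducts

/-! ### Regularity of `Rep A` and `D` -/

section Regularity

variable {C : Type u} [Category.{v} C] [MonoidalCategory C] [Preadditive C]
  [MonoidalPreadditive C] [Linear ℂ C] [MonoidalLinear ℂ C] [BraidedCategory C]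
  [RigidCategory C] {A : C} [MonObj A] [IsCommMonObj A]

/-- For a quasi-inverse `g` in `C`, linearity of `f` gives `f ≫ average c g ≫ f = average c (f ≫ g ≫
f) = d • f`. -/
lemma IsVonNeumannRegular.mod (h : IsVonNeumannRegular C) {θ : Balancing C}
    (hA : IsRigidAlgebra θ A) (hθ : θ.θ.hom.app A = 𝟙 A) : IsVonNeumannRegular (Mod C A) := by
  intro M N f
  obtain ⟨c, d, hd, hcd, hc⟩ := hA.exists_casimir hθ
  obtain ⟨g, hg⟩ := h _ _ f.hom
  refine ⟨d⁻¹ • modHom (average c g) (average_linear hc g), Mod.hom_ext _ _ ?_⟩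
  have h1 := average_linear_eq hcd f
  rw [← hg, comp_average, average_comp] at h1
  simp only [Mod.comp_hom', mod_smul_hom', modHom_hom, Linear.smul_comp, Linear.comp_smul]
  rw [h1, hg, smul_smul, inv_mul_cancel₀ hd, one_smul]

variable {G : Type w} [Group G] [Fintype G]

/-- Maschke's argument: the sum of the conjugates of `u` under `G` is equivariant, and each
conjugate is again a quasi-inverse of the equivariant `f`. -/
lemma IsVonNeumannRegular.equivMod (h : IsVonNeumannRegular (Mod C A))
    (π : G →* Aut (Mon.mk A)) : IsVonNeumannRegular (EquivMod π) := by
  intro X Y f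
  obtain ⟨u, hu⟩ := h _ _ f.f
  have hu' : f.f.hom ≫ u.hom ≫ f.f.hom = f.f.hom := congrArg (fun f => f.hom) hu
  -- The twists by `π_g` and `π_{g⁻¹}` cancel, so conjugates of linear maps are linear.
  have hlin : ∀ g, γ[A, Y.M.X] ≫ Y.φ g ≫ u.hom ≫ X.φ g⁻¹ =
      A ◁ (Y.φ g ≫ u.hom ≫ X.φ g⁻¹) ≫ γ[A, X.M.X] := fun g => by
    have h1 : γ[A, Y.M.X] ≫ Y.φ g ≫ u.hom ≫ X.φ g⁻¹ = (autHom π g ⊗ₘ Y.φ g) ≫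
        (𝟙 A ⊗ₘ u.hom) ≫ (autHom π g⁻¹ ⊗ₘ X.φ g⁻¹) ≫ γ[A, X.M.X] := by
      rw [reassoc_of% (Y.φ_smul g), reassoc_of% (mod_smul_hom u), X.φ_smul,
        MonoidalCategory.id_tensorHom]
    rw [h1, tensorHom_comp_tensorHom_assoc, tensorHom_comp_tensorHom_assoc, Category.comp_id,
      autHom_comp_inv, MonoidalCategory.id_tensorHom, Category.assoc]
  let k : Y ⟶ X :=
    { f := ∑ g, modHom (Y.φ g ≫ u.hom ≫ X.φ g⁻¹) (hlin g)
      comm := fun x => by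
        have e : (∑ g, modHom (Y.φ g ≫ u.hom ≫ X.φ g⁻¹) (hlin g)).hom =
            ∑ g, Y.φ g ≫ u.hom ≫ X.φ g⁻¹ := map_sum (modHomAddHom Y.M X.M) _ _
        rw [e, Preadditive.comp_sum, Preadditive.sum_comp]
        refine Fintype.sum_equiv (Equiv.mulRight x) _ _ fun g => ?_
        simp only [Equiv.coe_mulRight, Category.assoc, ← X.φ_mul, Y.φ_mul g x, mul_inv_rev,
          mul_inv_cancel_left] }
  have hk : k.f.hom = ∑ g, Y.φ g ≫ u.hom ≫ X.φ g⁻¹ := map_sum (modHomAddHom Y.M X.M) _ _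
  have hG : (Fintype.card G : ℂ) ≠ 0 := Nat.cast_ne_zero.mpr Fintype.card_ne_zero
  have hfk : f.f.hom ≫ k.f.hom ≫ f.f.hom = (Fintype.card G : ℂ) • f.f.hom := by
    rw [hk, Preadditive.sum_comp, Preadditive.comp_sum]
    rw [Finset.sum_congr rfl (g := fun _ => f.f.hom), Finset.sum_const, Finset.card_univ,
      Nat.cast_smul_eq_nsmul]
    intro g _
    simp only [Category.assoc]
    rw [f.comm, ← reassoc_of% (f.comm g), reassoc_of% hu', ← f.comm, ← Category.assoc,
      ← X.φ_mul, inv_mul_cancel, X.φ_one, Category.id_comp]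
  refine ⟨⟨(Fintype.card G : ℂ)⁻¹ • k.f, fun x => ?_⟩, ?_⟩
  · rw [mod_smul_hom', Linear.comp_smul, k.comm, Linear.smul_comp]
  · ext1
    refine Mod.hom_ext _ _ ?_
    change f.f.hom ≫ ((Fintype.card G : ℂ)⁻¹ • k.f.hom) ≫ f.f.hom = f.f.hom
    rw [Linear.smul_comp, Linear.comp_smul, hfk, smul_smul, inv_mul_cancel₀ hG, one_smul]

/-- `D` is semisimple. -/
theorem isSemisimpleCat_equivMod [∀ X Y : C, FiniteDimensional ℂ (X ⟶ Y)] [HasFiniteBiproducts C]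
    (hC : IsSemisimpleCat C) {θ : Balancing C} (hA : IsRigidAlgebra θ A)
    (hθ : θ.θ.hom.app A = 𝟙 A) (π : G →* Aut (Mon.mk A)) : IsSemisimpleCat (EquivMod π) := by
  have := hC.isIdempotentComplete
  exact IsVonNeumannRegular.isSemisimpleCat ((hC.isVonNeumannRegular.mod hA hθ).equivMod π)
    ((isRetractLength_finrank_end (C := C)).comp (EquivMod.forget π ⋙ Mod.forget A))

/-- `D⁰` is semisimple. -/
theorem isSemisimpleCat_equivMod₀ [∀ X Y : C, FiniteDimensional ℂ (X ⟶ Y)] [HasFiniteBiproducts C]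
    (hC : IsSemisimpleCat C) {θ : Balancing C} (hA : IsRigidAlgebra θ A)
    (hθ : θ.θ.hom.app A = 𝟙 A) (π : G →* Aut (Mon.mk A)) : IsSemisimpleCat (EquivMod₀ π) := by
  have := hC.isIdempotentComplete
  exact IsVonNeumannRegular.isSemisimpleCat
    (((hC.isVonNeumannRegular.mod hA hθ).equivMod π).fullSubcategory (isLocalEquiv π))
    ((isRetractLength_finrank_end (C := C)).comp
      ((isLocalEquiv π).ι ⋙ EquivMod.forget π ⋙ Mod.forget A))

end Regularity

end

end Orbifold

namespace Orbifold

open scoped MonObj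

set_option linter.unusedSectionVars false

noncomputable section

/-! ### Schur's lemma and the cocycle of a family of simple modules -/

section Schur

variable {C : Type u} [Category.{v} C] [MonoidalCategory C] [Preadditive C]
  [MonoidalPreadditive C] {A : C} [MonObj A]

lemma mod_hom_ne_zero {M N : Mod C A} {f : M ⟶ N} : f.hom ≠ 0 ↔ f ≠ 0 :=
  not_congr ⟨fun h => Mod.hom_ext _ _ h, fun h => by rw [h]; rfl⟩

lemma simple_hom_id_ne_zero (M : Mod C A) [Simple M] : 𝟙 M.X ≠ 0 :=
  mod_hom_ne_zero.mpr (id_nonzero M)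

lemma ne_zero_of_isIso_of_simple {M N : Mod C A} [Simple M] (f : M.X ⟶ N.X) [IsIso f] : f ≠ 0 := by
  intro h
  subst h
  exact simple_hom_id_ne_zero M (by rw [← IsIso.hom_inv_id (0 : M.X ⟶ N.X), zero_comp])

/-- A quotient of two semilinear morphisms is linear. -/
lemma inv_comp_linear {M N P : Mod C A} (a : A ⟶ A) [IsIso a] (f : M.X ⟶ N.X) (f' : M.X ⟶ P.X)
    [IsIso f] (hf : γ[A, M.X] ≫ f = (a ⊗ₘ f) ≫ γ[A, N.X])
    (hf' : γ[A, M.X] ≫ f' = (a ⊗ₘ f') ≫ γ[A, P.X]) :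
    γ[A, N.X] ≫ inv f ≫ f' = A ◁ (inv f ≫ f') ≫ γ[A, P.X] := by
  rw [← cancel_epi (a ⊗ₘ f), ← reassoc_of% hf, IsIso.hom_inv_id_assoc, hf',
    ← MonoidalCategory.id_tensorHom, tensorHom_comp_tensorHom_assoc, Category.comp_id,
    IsIso.hom_inv_id_assoc]

variable [Linear ℂ C] [MonoidalLinear ℂ C] [∀ X Y : C, FiniteDimensional ℂ (X ⟶ Y)]
  [HasKernels (Mod C A)]

lemma exists_smul_id (M : Mod C A) [Simple M] (f : M.X ⟶ M.X)
    (hf : γ[A, M.X] ≫ f = A ◁ f ≫ γ[A, M.X]) : ∃ c : ℂ, f = c • 𝟙 M.X := by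
  obtain ⟨c, hc⟩ := endomorphism_simple_eq_smul_id ℂ (modHom f hf)
  exact ⟨c, (congrArg (fun f => f.hom) hc).symm⟩

/-- The quotient of two `a`-semilinear isomorphisms is a linear endomorphism of a simple module,
hence a scalar. -/
lemma exists_unit_smul {M N : Mod C A} [Simple M] [Simple N] (a : A ⟶ A) [IsIso a]
    (f f' : M.X ⟶ N.X) [IsIso f] [IsIso f'] (hf : γ[A, M.X] ≫ f = (a ⊗ₘ f) ≫ γ[A, N.X])
    (hf' : γ[A, M.X] ≫ f' = (a ⊗ₘ f') ≫ γ[A, N.X]) : ∃ c : ℂˣ, f' = (c : ℂ) • f := by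
  obtain ⟨c, hc⟩ := exists_smul_id N (inv f ≫ f') (inv_comp_linear a f f' hf hf')
  have h : f' = c • f := by
    rw [← IsIso.hom_inv_id_assoc f f', hc, Linear.comp_smul, Category.comp_id]
  have hc0 : c ≠ 0 := by
    rintro rfl
    exact ne_zero_of_isIso_of_simple f' (by rw [h, zero_smul])
  exact ⟨Units.mk0 c hc0, h⟩

end Schur

namespace TwistedFamily

variable {C : Type u} [Category.{v} C] [MonoidalCategory C] {A : C} [MonObj A]
  {G : Type w} [Group G] {π : G →* Aut (Mon.mk A)} {O : Type*} [MulAction G O]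
  (R : TwistedFamily π O)

instance (g : G) : IsIso (autHom π g) :=
  ⟨autHom π g⁻¹, autHom_comp_inv π g, by simpa using autHom_comp_inv π g⁻¹⟩

lemma φC_congr {g g' : G} (e : g = g') {s t : O} (h : g • s = t) (h' : g' • s = t) :
    R.φC g h = R.φC g' h' := by
  subst e; rfl

lemma φC_comp_semilinear (g h : G) {s t r : O} (h1 : h • s = t) (h2 : g • t = r) :
    γ[A, (R.X s).X] ≫ R.φC h h1 ≫ R.φC g h2 =
      (autHom π (g * h) ⊗ₘ (R.φC h h1 ≫ R.φC g h2)) ≫ γ[A, (R.X r).X] := by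
  rw [reassoc_of% (R.φC_semilinear h h1), R.φC_semilinear g h2, tensorHom_comp_tensorHom_assoc,
    autHom_mul]

variable [Preadditive C] [MonoidalPreadditive C] [Linear ℂ C]

lemma φC_smul_injective (hS : ∀ s, Simple (R.X s)) (g : G) {s t : O} (h : g • s = t) {a b : ℂ}
    (hab : a • R.φC g h = b • R.φC g h) : a = b := by
  have := hS s
  have := R.φC_isIso g h
  exact smul_left_injective ℂ (ne_zero_of_isIso_of_simple (R.φC g h)) hab

/-- There is a unique cocycle. -/
theorem existsUnique_hasCocycle [MonoidalLinear ℂ C] [∀ X Y : C, FiniteDimensional ℂ (X ⟶ Y)]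
    [HasKernels (Mod C A)] (hS : ∀ s, Simple (R.X s)) : ∃! α, R.HasCocycle α := by
  -- The value of the cocycle is indexed by the target `r`, so the source of the composite has to be
  -- `h⁻¹ • g⁻¹ • r`.
  have h0 : ∀ (g h : G) (r : O), ∃ c : ℂˣ,
      R.φC h (smul_inv_smul h (g⁻¹ • r)) ≫ R.φC g (smul_inv_smul g r) =
      (c : ℂ) • R.φC (g * h) (by rw [mul_smul, smul_inv_smul, smul_inv_smul]) := fun g h r => by
    have := hS r
    have := hS (h⁻¹ • g⁻¹ • r)
    have := R.φC_isIso h (smul_inv_smul h (g⁻¹ • r))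
    have := R.φC_isIso g (smul_inv_smul g r)
    have h3 : (g * h) • h⁻¹ • g⁻¹ • r = r := by rw [mul_smul, smul_inv_smul, smul_inv_smul]
    have := R.φC_isIso (g * h) h3
    exact exists_unit_smul (autHom π (g * h)) _ _ (R.φC_semilinear _ h3)
      (R.φC_comp_semilinear g h _ _)
  choose a ha' using h0
  have ha : ∀ (g h : G) {s t r : O} (h1 : h • s = t) (h2 : g • t = r) (h3 : (g * h) • s = r),
      R.φC h h1 ≫ R.φC g h2 = ((a g h r : ℂˣ) : ℂ) • R.φC (g * h) h3 := by
    intro g h s t r h1 h2 h3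
    obtain rfl : t = g⁻¹ • r := by rw [← h2, inv_smul_smul]
    obtain rfl : s = h⁻¹ • g⁻¹ • r := by rw [← h1, inv_smul_smul]
    exact ha' g h r
  refine ⟨⟨a, fun g h k r => ?_⟩, fun g h => ha g h, fun β hβ => ?_⟩
  · have h1 : g • g⁻¹ • r = r := smul_inv_smul g r
    have h2 : h • h⁻¹ • g⁻¹ • r = g⁻¹ • r := smul_inv_smul h _
    have h3 : k • k⁻¹ • h⁻¹ • g⁻¹ • r = h⁻¹ • g⁻¹ • r := smul_inv_smul k _
    have h12 : (g * h) • h⁻¹ • g⁻¹ • r = r := by rw [mul_smul, h2, h1]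
    have h23 : (h * k) • k⁻¹ • h⁻¹ • g⁻¹ • r = g⁻¹ • r := by rw [mul_smul, h3, h2]
    have h123 : (g * h * k) • k⁻¹ • h⁻¹ • g⁻¹ • r = r := by rw [mul_smul, h3, h12]
    have h123' : (g * (h * k)) • k⁻¹ • h⁻¹ • g⁻¹ • r = r := by rw [mul_smul, h23, h1]
    -- The cocycle identity compares the scalars from the two bracketings of a triple composite.
    have e : (R.φC k h3 ≫ R.φC h h2) ≫ R.φC g h1 = R.φC k h3 ≫ R.φC h h2 ≫ R.φC g h1 :=
      Category.assoc _ _ _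
    rw [ha h k h3 h2 h23, ha g h h2 h1 h12, Linear.smul_comp, Linear.comp_smul,
      ha g (h * k) h23 h1 h123', ha (g * h) k h3 h12 h123, smul_smul (_ : ℂ) (_ : ℂ),
      smul_smul (_ : ℂ) (_ : ℂ),
      R.φC_congr (mul_assoc g h k).symm h123' h123] at e
    exact Units.ext (by simpa using (R.φC_smul_injective hS _ _ e).symm)
  · ext g h r
    have h1 : h • h⁻¹ • g⁻¹ • r = g⁻¹ • r := smul_inv_smul h _
    have h2 : g • g⁻¹ • r = r := smul_inv_smul g r
    have h3 : (g * h) • h⁻¹ • g⁻¹ • r = r := by rw [mul_smul, h1, h2]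
    exact R.φC_smul_injective hS _ h3 ((hβ g h h1 h2 h3).symm.trans (ha g h h1 h2 h3))

end TwistedFamily

/-! ### Graded components of representations of twisted algebras -/

section Representations

variable {G : Type w} [Group G] [Fintype G] {O : Type*} [MulAction G O] {α : TwoCocycle G O}

namespace TwistedAlg

open Classical in
lemma δ_mul_δ (s t : O) : δ α s * δ α t = if s = t then δ α s else 0 := by
  have h : ∀ s t, δ α s * δ α t = ((α 1 1 s : ℂˣ) : ℂ)⁻¹ • (E α 1 s * δ α t) := fun s t => by
    rw [← smul_mul_assoc, ← δ_eq]
  split_ifs with hst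
  · subst hst
    rw [h, E_mul_δ 1 (one_smul G s), ← δ_eq]
  · ext k r
    rw [mul_apply]
    simp only [zero_apply]
    refine Finset.sum_eq_zero fun g _ => ?_
    by_cases hg : g = 1
    · subst hg
      by_cases hr : r = s
      · subst hr
        simp [δ, ofFun, hst]
      · simp [δ, ofFun, hr]
    · simp [δ, ofFun, one_apply, hg]

lemma sum_δ [Fintype O] : ∑ s, δ α s = 1 := by
  classical
  ext k r
  have : (∑ s, δ α s) k r = ∑ s, δ α s k r := by
    have := Finset.sum_apply k Finset.univ fun s => (δ α s : G → O → ℂ)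
    exact (congrFun this r).trans (Finset.sum_apply r _ _)
  rw [this]
  simp [δ, ofFun]

lemma sum_E [Fintype O] (a : TwistedAlg α) : a = ∑ g, ∑ s, a g s • E α g s := by
  classical
  ext k r
  have : (∑ g, ∑ s, a g s • E α g s) k r = ∑ g, ∑ s, (a g s • E α g s) k r := by
    have h1 := Finset.sum_apply k Finset.univ fun g => ((∑ s, a g s • E α g s : TwistedAlg α) : G → O → ℂ)
    refine ((congrFun h1 r).trans (Finset.sum_apply r _ _)).trans (Finset.sum_congr rfl fun g _ => ?_)
    have h2 := Finset.sum_apply k Finset.univ fun s => ((a g s • E α g s : TwistedAlg α) : G → O → ℂ)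
    exact (congrFun h2 r).trans (Finset.sum_apply r _ _)
  rw [this, Finset.sum_eq_single k, Finset.sum_eq_single r]
  · simp [E]
  · intro s _ hs
    simp [E, hs.symm]
  · simp
  · intro g _ hg
    exact Finset.sum_eq_zero fun s _ => by simp [E, hg.symm]
  · simp

end TwistedAlg

namespace TwistedRep

open TwistedAlg

variable (V V' V'' : TwistedRep α)

/-- The projection of `V` to `V_s`. -/
def proj (s : O) : V →ₗ[ℂ] V.comp s := (Algebra.lsmul ℂ ℂ V (δ α s)).rangeRestrict

lemma coe_proj (s : O) (v : V) : (V.proj s v : V) = δ α s • v := rfl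

open Classical in
lemma δ_smul_of_mem {s t : O} {v : V} (hv : v ∈ V.comp t) :
    δ α s • v = if s = t then v else 0 := by
  obtain ⟨w, rfl⟩ := hv
  change δ α s • δ α t • w = if s = t then δ α t • w else 0
  rw [← mul_smul, δ_mul_δ]
  split_ifs with h
  · rw [h]
  · rw [zero_smul]

lemma sum_proj [Fintype O] (v : V) : ∑ s, (V.proj s v : V) = v := by
  simp only [coe_proj]
  rw [← Finset.sum_smul, sum_δ, one_smul]

lemma E_smul (g : G) {s t : O} (h : g • s = t) (v : V) :
    E α g t • v = (V.act g h (V.proj s v) : V) := by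
  change _ = T α g • δ α s • v
  rw [← mul_smul, T_mul_δ g h]

variable {V V' V''}

/-- The component of degree `s` of a morphism of representations. -/
def compMap (L : V →ₗ[TwistedAlg α] V') (s : O) : V.comp s →ₗ[ℂ] V'.comp s :=
  (L.restrictScalars ℂ).restrict (by
    rintro _ ⟨v, rfl⟩
    exact ⟨L v, (L.map_smul (δ α s) v).symm⟩)

lemma act_comp_compMap (L : V →ₗ[TwistedAlg α] V') (g : G) {s t : O} (h : g • s = t) :
    V'.act g h ∘ₗ compMap L s = compMap L t ∘ₗ V.act g h := by
  ext v
  exact (L.map_smul (T α g) v).symm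

lemma hom_ext_compMap [Finite O] {L L' : V →ₗ[TwistedAlg α] V'}
    (h : ∀ s, compMap L s = compMap L' s) : L = L' := by
  have := Fintype.ofFinite O
  ext v
  rw [← V.sum_proj v, map_sum, map_sum]
  exact Finset.sum_congr rfl fun s _ =>
    congrArg Subtype.val (DFunLike.congr_fun (h s) (V.proj s v))

/-- An equivariant family of linear maps of the graded components comes from a morphism of
representations. -/
lemma exists_compMap_eq [Finite O] (Λ : ∀ s, V.comp s →ₗ[ℂ] V'.comp s)
    (hΛ : ∀ (g : G) {s t : O} (h : g • s = t), V'.act g h ∘ₗ Λ s = Λ t ∘ₗ V.act g h) :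
    ∃ L : V →ₗ[TwistedAlg α] V', ∀ s, compMap L s = Λ s := by
  classical
  have := Fintype.ofFinite O
  -- The direct sum of the `Λ s`, read through `V = ⨁ V_s`.
  let F : V →ₗ[ℂ] V' := ∑ s, (V'.comp s).subtype ∘ₗ Λ s ∘ₗ V.proj s
  have hF : ∀ v, F v = ∑ s, (Λ s (V.proj s v) : V') := fun v => by simp [F]
  have hFs : ∀ (s : O) (v : V.comp s), F v = Λ s v := fun s v => by
    rw [hF, Finset.sum_eq_single s]
    · congr 2
      exact Subtype.ext (by rw [coe_proj, V.δ_smul_of_mem v.2, if_pos rfl])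
    · intro t _ hts
      have : V.proj t v = 0 := Subtype.ext (by
        rw [coe_proj, V.δ_smul_of_mem v.2, if_neg hts]; rfl)
      rw [this, map_zero]; rfl
    · simp
  have hδ : ∀ s v, V'.proj s (F v) = Λ s (V.proj s v) := fun s v => by
    refine Subtype.ext ?_
    rw [coe_proj, hF, Finset.smul_sum, Finset.sum_eq_single s]
    · rw [V'.δ_smul_of_mem (Λ s _).2, if_pos rfl]
    · intro t _ hts
      rw [V'.δ_smul_of_mem (Λ t _).2, if_neg hts.symm]
    · simp
  refine ⟨{ F with map_smul' := fun a v => ?_ }, fun s => ?_⟩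
  · change F (a • v) = a • F v
    -- It suffices to test the basis elements `δ_t T_g`, which act as the projection to degree `g⁻¹
    -- • t` followed by `act g`.
    conv_lhs => rw [sum_E a]
    conv_rhs => rw [sum_E a]
    simp only [Finset.sum_smul, map_sum, smul_assoc, map_smul]
    refine Finset.sum_congr rfl fun g _ => Finset.sum_congr rfl fun t _ => ?_
    have h : g • g⁻¹ • t = t := smul_inv_smul g t
    rw [V.E_smul g h, V'.E_smul g h, hFs, hδ]
    congr 1
    exact congrArg Subtype.val (DFunLike.congr_fun (hΛ g h) (V.proj _ v)).symm
  · ext v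
    exact hFs s v

end TwistedRep

end Representations

end

end Orbifold

namespace Orbifold

open scoped MonObj

set_option linter.unusedSectionVars false

noncomputable section

/-! ### Morphisms between the modules `V ⊠ X` -/

section Box

variable {C : Type u} [Category.{v} C] [MonoidalCategory C] [Preadditive C]
  [MonoidalPreadditive C] [HasFiniteBiproducts C] {A : C} [MonObj A] [Linear ℂ C]
  {V V' : Type*} [AddCommGroup V] [Module ℂ V] [FiniteDimensional ℂ V]
  [AddCommGroup V'] [Module ℂ V'] [FiniteDimensional ℂ V']

variable (V) in
/-- The injection of the copy of `X` with index `i` into `V ⊠ X`. -/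
def boxι (X : Mod C A) (i : Fin (Module.finrank ℂ V)) : X.X ⟶ (box V X).X :=
  directSum.ι (fun _ : Fin (Module.finrank ℂ V) => X) i

lemma boxι_π_self (X : Mod C A) (i) : boxι V X i ≫ boxπ V X i = 𝟙 X.X :=
  directSum.ι_π_self (fun _ : Fin (Module.finrank ℂ V) => X) i

lemma boxι_π_ne (X : Mod C A) {i j} (h : i ≠ j) : boxι V X i ≫ boxπ V X j = 0 :=
  directSum.ι_π_ne (fun _ : Fin (Module.finrank ℂ V) => X) h

lemma box_smul_ι (X : Mod C A) (i : Fin (Module.finrank ℂ V)) :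
    γ[A, X.X] ≫ boxι V X i = A ◁ boxι V X i ≫ γ[A, (box V X).X] :=
  directSum.smul_ι (fun _ : Fin (Module.finrank ℂ V) => X) i

lemma box_hom_ext' {X : Mod C A} {Z : C} {f g : (box V X).X ⟶ Z}
    (h : ∀ i, boxι V X i ≫ f = boxι V X i ≫ g) : f = g :=
  directSum.hom_ext' (Y := fun _ : Fin (Module.finrank ℂ V) => X) h

lemma boxι_comp_sum {X : Mod C A} {Z : C} (F : Fin (Module.finrank ℂ V) → (X.X ⟶ Z)) (i) :
    boxι V X i ≫ ∑ j, boxπ V X j ≫ F j = F i := by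
  rw [Preadditive.comp_sum, Finset.sum_eq_single i]
  · rw [← Category.assoc, boxι_π_self, Category.id_comp]
  · intro j _ hj
    rw [← Category.assoc, boxι_π_ne X hj.symm, zero_comp]
  · simp

lemma boxι_boxMap_π {X X' : Mod C A} (L : V →ₗ[ℂ] V') (f : X.X ⟶ X'.X) (i j) :
    boxι V X i ≫ boxMap L f ≫ boxπ V' X' j =
      ((Module.finBasis ℂ V').repr (L (Module.finBasis ℂ V i)) j) • f := by
  rw [boxMap_π]
  simp only [← Linear.comp_smul]
  exact boxι_comp_sum _ i

/-- The matrix entries of `boxMap L f` are those of `L` times `f`, and `f ≠ 0` can be cancelled. -/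
lemma boxMap_injective {X X' : Mod C A} {f : X.X ⟶ X'.X} (hf : f ≠ 0) {L L' : V →ₗ[ℂ] V'}
    (h : boxMap L f = boxMap L' f) : L = L' := by
  refine (Module.finBasis ℂ V).ext fun i => (Module.finBasis ℂ V').repr.injective ?_
  ext j
  have := congrArg (fun t => boxι V X i ≫ t ≫ boxπ V' X' j) h
  simp only [boxι_boxMap_π] at this
  exact smul_left_injective ℂ hf this

/-- Linear morphisms `V ⊠ X ⟶ V' ⊠ X` come from linear maps `V → V'`, if `X` is simple. -/
lemma exists_eq_boxMap [MonoidalLinear ℂ C] [∀ X Y : C, FiniteDimensional ℂ (X ⟶ Y)]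
    [HasKernels (Mod C A)] (X : Mod C A) [Simple X] (f : (box V X).X ⟶ (box V' X).X)
    (hf : γ[A, (box V X).X] ≫ f = A ◁ f ≫ γ[A, (box V' X).X]) :
    ∃ L : V →ₗ[ℂ] V', f = boxMap L (𝟙 X.X) := by
  have h : ∀ i j, ∃ c : ℂ, boxι V X i ≫ f ≫ boxπ V' X j = c • 𝟙 X.X := fun i j =>
    exists_smul_id X _ (by
      rw [reassoc_of% (box_smul_ι (V := V) X i), reassoc_of% hf, box_smul_π]
      simp)
  choose c hc using h
  refine ⟨Matrix.toLin (Module.finBasis ℂ V) (Module.finBasis ℂ V') (Matrix.of fun j i => c i j),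
    box_hom_ext' fun i => box_hom_ext fun j => ?_⟩
  rw [Category.assoc, Category.assoc, hc, boxι_boxMap_π, Matrix.toLin_self]
  congr 1
  rw [map_sum, Finsupp.finsetSum_apply, Finset.sum_eq_single j]
  · simp
  · intro k _ hk
    simp [hk]
  · simp

/-- There are no nonzero linear morphisms `V ⊠ X ⟶ V' ⊠ X'` if there are none from `X` to `X'`. -/
lemma box_hom_eq_zero {X X' : Mod C A} (h : ∀ f : X ⟶ X', f = 0) (f : (box V X).X ⟶ (box V' X').X)
    (hf : γ[A, (box V X).X] ≫ f = A ◁ f ≫ γ[A, (box V' X').X]) : f = 0 := by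
  refine box_hom_ext' fun i => box_hom_ext fun j => ?_
  have := h (modHom (boxι V X i ≫ f ≫ boxπ V' X' j) (by
      rw [reassoc_of% (box_smul_ι (V := V) X i), reassoc_of% hf, box_smul_π]
      simp))
  rw [Category.assoc, comp_zero, zero_comp]
  exact congrArg (fun f => f.hom) this

end Box

/-! ### Full faithfulness of `V ↦ X_{V,O}` -/

namespace TwistedFamily

variable {C : Type u} [Category.{v} C] [MonoidalCategory C] [Preadditive C]
  [MonoidalPreadditive C] [HasFiniteBiproducts C] {A : C} [MonObj A] [Linear ℂ C]
  [MonoidalLinear ℂ C] {G : Type w} [Group G] [Fintype G] {π : G →* Aut (Mon.mk A)}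

section

variable {O : Type*} [MulAction G O] [Finite O] (R : TwistedFamily π O) {β : TwoCocycle G O}

/-- The injection of the summand of `s` into `⨁_s V_s ⊠ X_s`. -/
def sumι (V : TwistedRep β) (s : O) : (box (V.comp s) (R.X s)).X ⟶ (R.sumMod V).X :=
  directSum.ι (fun s => box (V.comp s) (R.X s)) s

variable (V V' V'' : TwistedRep β)

lemma sumι_π_self (s : O) : R.sumι V s ≫ R.sumπ V s = 𝟙 _ :=
  directSum.ι_π_self (fun s => box (V.comp s) (R.X s)) s

lemma sumι_π_ne {s t : O} (h : s ≠ t) : R.sumι V s ≫ R.sumπ V t = 0 :=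
  directSum.ι_π_ne (fun s => box (V.comp s) (R.X s)) h

lemma sum_smul_ι (s : O) : γ[A, (box (V.comp s) (R.X s)).X] ≫ R.sumι V s =
    A ◁ R.sumι V s ≫ γ[A, (R.sumMod V).X] :=
  directSum.smul_ι (fun s => box (V.comp s) (R.X s)) s

variable {V} in
lemma sum_hom_ext' {Z : C} {f g : (R.sumMod V).X ⟶ Z}
    (h : ∀ s, R.sumι V s ≫ f = R.sumι V s ≫ g) : f = g :=
  directSum.hom_ext' (Y := fun s => box (V.comp s) (R.X s)) h

lemma sumι_φ (g : G) {s t : O} (h : g • s = t) :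
    R.sumι V s ≫ R.sumφ V g = boxMap (V.act g h) (R.φC g h) ≫ R.sumι V t := by
  refine R.sum_hom_ext fun r => ?_
  rw [Category.assoc, Category.assoc, R.sumφ_π V g (smul_inv_smul g r)]
  by_cases hr : t = r
  · subst hr
    obtain rfl : s = g⁻¹ • t := by rw [← h, inv_smul_smul]
    rw [reassoc_of% (R.sumι_π_self V), sumι_π_self, Category.comp_id]
  · have : s ≠ g⁻¹ • r := fun e => hr (by rw [← h, e, smul_inv_smul])
    rw [reassoc_of% (R.sumι_π_ne V this), R.sumι_π_ne V hr, zero_comp, comp_zero]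

end

section

variable {O : Type*} [MulAction G O] [Finite O] {R : TwistedFamily π O} {α : TwoCocycle G O}
  (hα : R.HasCocycle α) {V V' V'' : TwistedRep α⁻¹}

/-- The morphism of `C` into `⨁_s V_s ⊠ X_s` with given components. -/
def sumLift {β : TwoCocycle G O} {V : TwistedRep β} {Z : C}
    (f : ∀ s, Z ⟶ (box (V.comp s) (R.X s)).X) : Z ⟶ (R.sumMod V).X :=
  directSum.lift f

lemma sumLift_π {β : TwoCocycle G O} {V : TwistedRep β} {Z : C}
    (f : ∀ s, Z ⟶ (box (V.comp s) (R.X s)).X) (s : O) : sumLift f ≫ R.sumπ V s = f s :=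
  directSum.lift_π f s

section HomC

variable {O' : Type*} [MulAction G O'] [Finite O'] {R' : TwistedFamily π O'}
  {α' : TwoCocycle G O'} {hα' : R'.HasCocycle α'} {W : TwistedRep α'⁻¹} {hα}

/-- The underlying morphism in `C` of a morphism `X_{V,O} ⟶ X_{W,O'}`. -/
def homC (f : R.obj hα V ⟶ R'.obj hα' W) : (R.sumMod V).X ⟶ (R'.sumMod W).X := f.f.hom

lemma homC_ext {f f' : R.obj hα V ⟶ R'.obj hα' W}
    (h : ∀ s, homC f ≫ R'.sumπ W s = homC f' ≫ R'.sumπ W s) : f = f' := by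
  ext1
  exact Mod.hom_ext _ _ (R'.sum_hom_ext h)

lemma homC_linear (f : R.obj hα V ⟶ R'.obj hα' W) :
    γ[A, (R.sumMod V).X] ≫ homC f = A ◁ homC f ≫ γ[A, (R'.sumMod W).X] :=
  mod_smul_hom f.f

lemma homC_comm (f : R.obj hα V ⟶ R'.obj hα' W) (g : G) :
    R.sumφ V g ≫ homC f = homC f ≫ R'.sumφ W g :=
  f.comm g

lemma homC_zero : homC (0 : R.obj hα V ⟶ R'.obj hα' W) = 0 := rfl

lemma homC_entry_linear (f : R.obj hα V ⟶ R'.obj hα' W) (s : O) (t : O') :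
    γ[A, (box (V.comp s) (R.X s)).X] ≫ R.sumι V s ≫ homC f ≫ R'.sumπ W t =
      A ◁ (R.sumι V s ≫ homC f ≫ R'.sumπ W t) ≫ γ[A, (box (W.comp t) (R'.X t)).X] := by
  rw [reassoc_of% (R.sum_smul_ι V s), reassoc_of% (homC_linear f), sum_smul_π]
  simp

lemma homC_entry_eq_zero [HasKernels (Mod C A)] (hS : ∀ s, Simple (R.X s))
    (hS' : ∀ s, Simple (R'.X s)) (f : R.obj hα V ⟶ R'.obj hα' W) (s : O) (t : O')
    (h : ¬ Nonempty (R.X s ≅ R'.X t)) : R.sumι V s ≫ homC f ≫ R'.sumπ W t = 0 := by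
  have := hS s
  have := hS' t
  refine box_hom_eq_zero (fun u => ?_) _ (homC_entry_linear f s t)
  by_contra hu
  have := isIso_of_hom_simple hu
  exact h ⟨asIso u⟩

end HomC

/-- The underlying morphism in `C` of the morphism given by a morphism of representations. -/
def objMapC (R : TwistedFamily π O) {α : TwoCocycle G O} {V V' : TwistedRep α⁻¹}
    (L : V →ₗ[TwistedAlg α⁻¹] V') : (R.sumMod V).X ⟶ (R.sumMod V').X :=
  sumLift fun s => R.sumπ V s ≫ boxMap (TwistedRep.compMap L s) (𝟙 (R.X s).X)

lemma objMapC_π (L : V →ₗ[TwistedAlg α⁻¹] V') (s : O) :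
    R.objMapC L ≫ R.sumπ V' s = R.sumπ V s ≫ boxMap (TwistedRep.compMap L s) (𝟙 (R.X s).X) :=
  sumLift_π _ s

lemma objMapC_linear (L : V →ₗ[TwistedAlg α⁻¹] V') :
    γ[A, (R.sumMod V).X] ≫ R.objMapC L = A ◁ R.objMapC L ≫ γ[A, (R.sumMod V').X] := by
  refine R.sum_hom_ext fun s => ?_
  have hb := boxMap_semilinear (TwistedRep.compMap L s) (𝟙 (R.X s).X) (𝟙 A) (by simp)
  rw [MonoidalCategory.id_tensorHom] at hb
  rw [Category.assoc, Category.assoc, objMapC_π, sum_smul_π,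
    ← MonoidalCategory.whiskerLeft_comp_assoc, objMapC_π, reassoc_of% (R.sum_smul_π V s), hb]
  simp

lemma objMapC_comm (L : V →ₗ[TwistedAlg α⁻¹] V') (g : G) :
    R.sumφ V g ≫ R.objMapC L = R.objMapC L ≫ R.sumφ V' g := by
  refine R.sum_hom_ext fun t => ?_
  have h := smul_inv_smul g t
  rw [Category.assoc, Category.assoc, objMapC_π, R.sumφ_π V' g h,
    reassoc_of% (objMapC_π (R := R) L (g⁻¹ • t)), reassoc_of% (R.sumφ_π V g h), boxMap_comp,
    boxMap_comp, TwistedRep.act_comp_compMap, Category.comp_id, Category.id_comp]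

/-- The morphism `X_{V,O} ⟶ X_{V',O}` given by a morphism of representations. -/
def objMap (L : V →ₗ[TwistedAlg α⁻¹] V') : R.obj hα V ⟶ R.obj hα V' where
  f := modHom (M := R.sumMod V) (N := R.sumMod V') (R.objMapC L) (objMapC_linear L)
  comm g := objMapC_comm L g

lemma objMap_π (L : V →ₗ[TwistedAlg α⁻¹] V') (s : O) :
    homC (objMap hα L) ≫ R.sumπ V' s =
      R.sumπ V s ≫ boxMap (TwistedRep.compMap L s) (𝟙 (R.X s).X) :=
  objMapC_π L s

lemma objMap_id : objMap hα (LinearMap.id : V →ₗ[TwistedAlg α⁻¹] V) = 𝟙 _ :=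
  homC_ext fun s => by
    have h1 : homC (𝟙 (R.obj hα V)) = 𝟙 (R.sumMod V).X := rfl
    have h2 : TwistedRep.compMap (LinearMap.id : V →ₗ[TwistedAlg α⁻¹] V) s = LinearMap.id := rfl
    rw [objMap_π, h1, h2, boxMap_id, Category.comp_id, Category.id_comp]

lemma objMap_comp (L : V →ₗ[TwistedAlg α⁻¹] V') (L' : V' →ₗ[TwistedAlg α⁻¹] V'') :
    objMap hα L ≫ objMap hα L' = objMap hα (L' ∘ₗ L) :=
  homC_ext fun s => by
    have h1 : homC (objMap hα L ≫ objMap hα L') = homC (objMap hα L) ≫ homC (objMap hα L') := rfl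
    have h2 : TwistedRep.compMap (L' ∘ₗ L) s =
      TwistedRep.compMap L' s ∘ₗ TwistedRep.compMap L s := rfl
    rw [objMap_π, h1, h2, Category.assoc, objMap_π, reassoc_of% (objMap_π hα L s), boxMap_comp,
      Category.comp_id]

/-- Faithfulness: the diagonal blocks recover the components of `L`. -/
lemma objMap_injective (hS : ∀ s, Simple (R.X s)) {L L' : V →ₗ[TwistedAlg α⁻¹] V'}
    (h : objMap hα L = objMap hα L') : L = L' := by
  refine TwistedRep.hom_ext_compMap fun s => ?_
  have := hS s
  have e := congrArg (fun t => R.sumι V s ≫ homC t ≫ R.sumπ V' s) h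
  simp only [objMap_π] at e
  rw [reassoc_of% (R.sumι_π_self V), reassoc_of% (R.sumι_π_self V)] at e
  exact boxMap_injective (simple_hom_id_ne_zero _) e

lemma objMap_zero : objMap hα (0 : V →ₗ[TwistedAlg α⁻¹] V') = 0 :=
  homC_ext fun s => by
    have h : TwistedRep.compMap (0 : V →ₗ[TwistedAlg α⁻¹] V') s =
      (0 : ℂ) • (0 : V.comp s →ₗ[ℂ] V'.comp s) := by rw [zero_smul]; rfl
    rw [objMap_π, homC_zero, h, boxMap_smul_left, zero_smul, comp_zero, zero_comp]

variable [∀ X Y : C, FiniteDimensional ℂ (X ⟶ Y)] [HasKernels (Mod C A)]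

/-- Fullness: off-diagonal blocks vanish because distinct `X_s` are not isomorphic, and diagonal
blocks are linear maps `Λ s` by Schur's lemma. Commutation with `φ(g)` makes the `Λ s` equivariant
after cancelling `φ_s(g)`. -/
lemma objMap_surjective (hS : ∀ s, Simple (R.X s))
    (hne : ∀ s t, Nonempty (R.X s ≅ R.X t) → s = t) (f : R.obj hα V ⟶ R.obj hα V') :
    ∃ L, f = objMap hα L := by
  have hd : ∀ s, ∃ L : V.comp s →ₗ[ℂ] V'.comp s,
      R.sumι V s ≫ homC f ≫ R.sumπ V' s = boxMap L (𝟙 (R.X s).X) := fun s => by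
    have := hS s
    exact exists_eq_boxMap (R.X s) _ (homC_entry_linear f s s)
  have hz : ∀ s t, s ≠ t → R.sumι V s ≫ homC f ≫ R.sumπ V' t = 0 := fun s t hst =>
    homC_entry_eq_zero hS hS f s t fun h => hst (hne s t h)
  choose Λ hΛ using hd
  have hfπ : ∀ s, homC f ≫ R.sumπ V' s = R.sumπ V s ≫ boxMap (Λ s) (𝟙 (R.X s).X) := fun s => by
    refine R.sum_hom_ext' fun t => ?_
    by_cases hst : t = s
    · subst hst
      rw [hΛ, reassoc_of% (R.sumι_π_self V)]
    · rw [hz t s hst, reassoc_of% (R.sumι_π_ne V hst), zero_comp]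
  obtain ⟨L, hL⟩ := TwistedRep.exists_compMap_eq Λ (fun g {s t} h => by
    have := hS s
    have := R.φC_isIso g h
    refine boxMap_injective (ne_zero_of_isIso_of_simple (R.φC g h)) ?_
    have e' := congrArg (fun u => R.sumι V s ≫ u ≫ R.sumπ V' t) (homC_comm f g)
    simp only [Category.assoc] at e'
    rw [hfπ, reassoc_of% (R.sumι_φ V g h), reassoc_of% (R.sumι_π_self V), R.sumφ_π V' g h,
      reassoc_of% (hfπ s), reassoc_of% (R.sumι_π_self V), boxMap_comp, boxMap_comp,
      Category.comp_id, Category.id_comp] at e'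
    exact e'.symm)
  exact ⟨L, homC_ext fun s => by rw [hfπ, objMap_π, hL]⟩

/-- An isomorphism of representations induces an isomorphism of objects of `D`. -/
def objMapIso (e : V ≃ₗ[TwistedAlg α⁻¹] V') : R.obj hα V ≅ R.obj hα V' where
  hom := objMap hα e.toLinearMap
  inv := objMap hα e.symm.toLinearMap
  hom_inv_id := by rw [objMap_comp, ← objMap_id]; congr 1; ext; simp
  inv_hom_id := by rw [objMap_comp, ← objMap_id]; congr 1; ext; simp

theorem nonempty_obj_iso_iff (hS : ∀ s, Simple (R.X s))
    (hne : ∀ s t, Nonempty (R.X s ≅ R.X t) → s = t) :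
    Nonempty (R.obj hα V ≅ R.obj hα V') ↔ Nonempty (V ≃ₗ[TwistedAlg α⁻¹] V') := by
  refine ⟨fun ⟨e⟩ => ?_, fun ⟨e⟩ => ⟨objMapIso hα e⟩⟩
  obtain ⟨L, hL⟩ := objMap_surjective hα hS hne e.hom
  obtain ⟨L', hL'⟩ := objMap_surjective hα hS hne e.inv
  refine ⟨LinearEquiv.ofLinearMap L L' ?_ ?_⟩
  · apply objMap_injective hα hS
    rw [← objMap_comp, ← hL, ← hL', objMap_id, e.inv_hom_id]
  · apply objMap_injective hα hS
    rw [← objMap_comp, ← hL, ← hL', objMap_id, e.hom_inv_id]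

/-- `X_{V,O}` is simple if `V` is irreducible. -/
theorem simple_obj (hS : ∀ s, Simple (R.X s)) (hne : ∀ s t, Nonempty (R.X s ≅ R.X t) → s = t)
    (hD : IsVonNeumannRegular (EquivMod π)) (hV : V.IsIrreducible) : Simple (R.obj hα V) := by
  have : IsSimpleModule (TwistedAlg α⁻¹) V := hV
  have := IsSimpleModule.nontrivial (TwistedAlg α⁻¹) V
  refine hD.simple_of_isIso_end (fun h => ?_) fun f hf => ?_
  · rw [← objMap_id, ← objMap_zero] at h
    obtain ⟨v, hv⟩ := exists_ne (0 : V)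
    exact hv (DFunLike.congr_fun (objMap_injective hα hS h) v)
  -- Every endomorphism comes from one of `V`, and nonzero endomorphisms of `V` are invertible by
  -- Schur's lemma.
  · obtain ⟨L, rfl⟩ := objMap_surjective hα hS hne f
    have hL : L ≠ 0 := by
      rintro rfl
      exact hf (objMap_zero hα)
    exact (objMapIso hα (LinearEquiv.ofBijective L (LinearMap.bijective_of_ne_zero hL))).isIso_hom

/-- Isomorphic objects `X_{V,O}`, `X_{V',O'}` contain isomorphic modules. -/
theorem exists_iso_of_obj_iso {O' : Type*} [MulAction G O'] [Finite O'] {R' : TwistedFamily π O'}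
    {α' : TwoCocycle G O'} (hα' : R'.HasCocycle α') {W : TwistedRep α'⁻¹}
    (hS : ∀ s, Simple (R.X s)) (hS' : ∀ s, Simple (R'.X s)) (hV : Simple (R.obj hα V))
    (e : R.obj hα V ≅ R'.obj hα' W) : ∃ s s', Nonempty (R.X s ≅ R'.X s') := by
  by_contra! H
  have h0 : e.hom = 0 := homC_ext fun t => R.sum_hom_ext' fun s => by
    rw [homC_entry_eq_zero hS hS' e.hom s t fun ⟨i⟩ => (H s t).false i, homC_zero, zero_comp,
      comp_zero]
  exact id_nonzero (R.obj hα V) (by rw [← e.hom_inv_id, h0, zero_comp])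

end

end TwistedFamily

end

end Orbifold

namespace Orbifold

open scoped MonObj

set_option linter.unusedSectionVars false

noncomputable section

/-! ### Graded representations -/

/-- A family of vector spaces `W_s` with maps `T_g : W_s → W_{gs}` that multiply as in the twisted
algebra. -/
structure GradedRep {G : Type w} [Group G] {O : Type u} [MulAction G O] (β : TwoCocycle G O) where
  W : O → Type v
  [addCommGroup : ∀ s, AddCommGroup (W s)]
  [module : ∀ s, Module ℂ (W s)]
  tw : ∀ (g : G) {s t : O}, g • s = t → (W s →ₗ[ℂ] W t)
  tw_mul : ∀ (g h : G) {s t r : O} (h1 : h • s = t) (h2 : g • t = r) (h3 : (g * h) • s = r)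
    (x : W s), tw g h2 (tw h h1 x) = ((β g h r : ℂˣ) : ℂ) • tw (g * h) h3 x
  tw_one : ∀ {s : O} (h : (1 : G) • s = s) (x : W s), tw 1 h x = ((β 1 1 s : ℂˣ) : ℂ) • x

namespace GradedRep

attribute [instance] addCommGroup module

variable {G : Type w} [Group G] {O : Type u} [MulAction G O] {β : TwoCocycle G O}
  (P : GradedRep β)

/-- Replaces the index `g⁻¹ • t` by any `s` with `g • s = t`, which avoids casts between the spaces
`W s`. -/
lemma tw_inv_smul (x : ∀ s, P.W s) (g : G) {s t : O} (h : g • s = t) :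
    P.tw g (smul_inv_smul g t) (x (g⁻¹ • t)) = P.tw g h (x s) := by
  obtain rfl : s = g⁻¹ • t := by rw [← h, inv_smul_smul]
  rfl

variable [Fintype G]

/-- The action of the twisted algebra on the product of the `W_s`. -/
def actHom (a : TwistedAlg β) : (∀ s, P.W s) →ₗ[ℂ] (∀ s, P.W s) :=
  LinearMap.pi fun t => ∑ g, a g t • P.tw g (smul_inv_smul g t) ∘ₗ LinearMap.proj (g⁻¹ • t)

lemma actHom_apply (a : TwistedAlg β) (x : ∀ s, P.W s) (t : O) :
    P.actHom a x t = ∑ g, a g t • P.tw g (smul_inv_smul g t) (x (g⁻¹ • t)) := by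
  simp [actHom]

/-- The action of the twisted algebra as a ring homomorphism. -/
def actRingHom : TwistedAlg β →+* Module.End ℂ (∀ s, P.W s) where
  toFun := P.actHom
  map_one' := by
    ext x t
    rw [actHom_apply, Finset.sum_eq_single 1 (fun g _ hg => by simp [TwistedAlg.one_apply, hg])
      (by simp), P.tw_inv_smul x 1 (one_smul G t), P.tw_one, TwistedAlg.one_apply, if_pos rfl,
      smul_smul, inv_mul_cancel₀ (Units.ne_zero _), one_smul]
    rfl
  map_mul' a b := by
    ext x t
    rw [Module.End.mul_apply, actHom_apply, actHom_apply]
    simp only [TwistedAlg.mul_apply, Finset.sum_smul]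
    rw [Finset.sum_comm]
    refine Finset.sum_congr rfl fun g _ => ?_
    rw [actHom_apply, map_sum, Finset.smul_sum]
    -- Substituting `k = g * h` matches the convolution product with the composites `T_g T_h = β(g,
    -- h) T_{gh}`.
    refine (Fintype.sum_equiv (Equiv.mulLeft g) _ _ fun h => ?_).symm
    have h1 := smul_inv_smul h (g⁻¹ • t)
    have h2 := smul_inv_smul g t
    have h3 : (g * h) • h⁻¹ • g⁻¹ • t = t := by rw [mul_smul, h1, h2]
    rw [Equiv.coe_mulLeft, inv_mul_cancel_left, map_smul, P.tw_mul g h h1 h2 h3, smul_smul,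
      smul_smul, P.tw_inv_smul x (g * h) h3]
  map_zero' := by ext x t; rw [actHom_apply]; simp
  map_add' a b := by
    ext x t
    rw [LinearMap.add_apply, Pi.add_apply]
    simp [actHom_apply, add_smul, Finset.sum_add_distrib]

open Classical in
/-- A nonzero graded representation receives a nonzero map from an irreducible one. -/
theorem exists_irreducible [Finite O] [∀ s, FiniteDimensional ℂ (P.W s)] (s₀ : O)
    [Nontrivial (P.W s₀)] :
    ∃ (V : TwistedRep β) (ψ : ∀ s, V.comp s →ₗ[ℂ] P.W s), V.IsIrreducible ∧
      (∀ (g : G) {s t : O} (h : g • s = t) (x : V.comp s), ψ t (V.act g h x) = P.tw g h (ψ s x)) ∧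
      ∃ s, ψ s ≠ 0 := by
  have := Fintype.ofFinite O
  let : Module (TwistedAlg β) (∀ s, P.W s) := Module.compHom _ P.actRingHom
  have hsmul : ∀ (a : TwistedAlg β) (x : ∀ s, P.W s) (t : O), (a • x) t =
      ∑ g, a g t • P.tw g (smul_inv_smul g t) (x (g⁻¹ • t)) := fun a x t => P.actHom_apply a x t
  have : IsScalarTower ℂ (TwistedAlg β) (∀ s, P.W s) := ⟨fun c a x => by
    funext t
    rw [hsmul, Pi.smul_apply, hsmul, Finset.smul_sum]
    simp [mul_smul]⟩
  -- Finite dimension over `ℂ` makes the module Artinian, so it has a minimal nonzero submodule `N`.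
  have : IsArtinian (TwistedAlg β) (∀ s, P.W s) := isArtinian_of_tower ℂ inferInstance
  have : Nontrivial (∀ s, P.W s) := Pi.nontrivial_at s₀
  obtain ⟨N, hN⟩ := IsAtomic.exists_atom (Submodule (TwistedAlg β) (∀ s, P.W s))
  have hN := isSimpleModule_iff_isAtom.mpr hN
  have : FiniteDimensional ℂ N := inferInstanceAs (FiniteDimensional ℂ (N.restrictScalars ℂ))
  -- `TwistedRep` requires a carrier in `Type`, while `N` may live in a larger universe, so its
  -- structure is transported to `ℂⁿ`.
  let e : N ≃ₗ[ℂ] (Fin (Module.finrank ℂ N) → ℂ) := (Module.finBasis ℂ N).equivFun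
  let : Module (TwistedAlg β) (Fin (Module.finrank ℂ N) → ℂ) :=
    AddEquiv.module _ e.symm.toAddEquiv
  have he : ∀ (a : TwistedAlg β) (x : Fin (Module.finrank ℂ N) → ℂ),
      e.symm (a • x) = a • e.symm x := fun a x => e.symm_apply_apply _
  have : IsScalarTower ℂ (TwistedAlg β) (Fin (Module.finrank ℂ N) → ℂ) := ⟨fun c a x => by
    apply e.symm.injective
    rw [he, map_smul, he, smul_assoc]⟩
  let V : TwistedRep β := { carrier := Fin (Module.finrank ℂ N) → ℂ }
  let e' : V ≃ₗ[TwistedAlg β] N := { e.symm with map_smul' := he }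
  have hV : V.IsIrreducible := IsSimpleModule.congr e'
  have hT : ∀ (g : G) {s t : O} (h : g • s = t) (x : ∀ s, P.W s),
      (TwistedAlg.T β g • x) t = P.tw g h (x s) := fun g s t h x => by
    rw [hsmul, Finset.sum_eq_single g (fun k _ hk => by simp [TwistedAlg.T, hk]) (by simp),
      P.tw_inv_smul x g h]
    simp [TwistedAlg.T]
  have hδ : ∀ {s t : O} (h : t ≠ s) (x : ∀ s, P.W s), (TwistedAlg.δ β s • x) t = 0 :=
    fun {s t} h x => by
      rw [hsmul]
      exact Finset.sum_eq_zero fun g _ => by simp [TwistedAlg.δ, TwistedAlg.ofFun, h]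
  let ψ : ∀ s, V.comp s →ₗ[ℂ] P.W s := fun s =>
    LinearMap.proj s ∘ₗ (N.restrictScalars ℂ).subtype ∘ₗ e.symm.toLinearMap ∘ₗ (V.comp s).subtype
  have hψ : ∀ s x, ψ s x = (e' (x : V) : ∀ s, P.W s) s := fun s x => rfl
  refine ⟨V, ψ, hV, fun g s t h x => ?_, ?_⟩
  · rw [hψ, hψ, ← hT g h]
    exact congrFun (congrArg Subtype.val (e'.map_smul (TwistedAlg.T β g) (x : V))) t
  · have : IsSimpleModule (TwistedAlg β) V := hV
    have := IsSimpleModule.nontrivial (TwistedAlg β) V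
    obtain ⟨v, hv⟩ := exists_ne (0 : V)
    obtain ⟨s, hs⟩ : ∃ s, (V.proj s v : V) ≠ 0 := by
      by_contra! H
      exact hv (by rw [← V.sum_proj v]; exact Finset.sum_eq_zero fun s _ => H s)
    -- The image of `δ_s v` in the product has no coordinate outside `s`; if `ψ s = 0` it has none
    -- at `s` either.
    refine ⟨s, fun h0 => hs ?_⟩
    apply e'.injective
    rw [map_zero]
    refine Subtype.ext (funext fun t => ?_)
    by_cases hts : t = s
    · subst hts
      exact (hψ t _).symm.trans (by rw [h0]; rfl)
    · have hx : TwistedAlg.δ β s • (V.proj s v : V) = V.proj s v := by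
        rw [V.δ_smul_of_mem (V.proj s v).2, if_pos rfl]
      rw [← hx, e'.map_smul]
      exact hδ hts _

end GradedRep

/-! ### The graded representation of an object of `D` -/

namespace TwistedFamily

variable {C : Type u} [Category.{v} C] [MonoidalCategory C] [Preadditive C]
  [MonoidalPreadditive C] [HasFiniteBiproducts C] {A : C} [MonObj A] [Linear ℂ C]
  [MonoidalLinear ℂ C] {G : Type w} [Group G] [Fintype G] {π : G →* Aut (Mon.mk A)}
  {O : Type*} [MulAction G O] [Finite O] (R : TwistedFamily π O) {α : TwoCocycle G O}

/-- The map `Hom(X_s, Y) → Hom(X_{gs}, Y)`, `f ↦ φ_s(g)⁻¹ f φ_Y(g)`. -/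
def homTw (Y : EquivMod π) (g : G) {s t : O} (h : g • s = t) :
    (R.X s ⟶ Y.M) →ₗ[ℂ] (R.X t ⟶ Y.M) where
  toFun f :=
    letI := R.φC_isIso g h
    modHom (inv (R.φC g h) ≫ f.hom ≫ Y.φ g) (inv_comp_linear (autHom π g) _ _
      (R.φC_semilinear g h) (by
        rw [reassoc_of% (mod_smul_hom f), Y.φ_smul, ← MonoidalCategory.id_tensorHom,
          tensorHom_comp_tensorHom_assoc, Category.id_comp]))
  map_add' f f' := by
    refine Mod.hom_ext _ _ ?_
    simp
  map_smul' c f := by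
    refine Mod.hom_ext _ _ ?_
    simp

-- The defining equation without the inverse. Later identities are checked after cancelling `φC` on
-- the left.
variable {R} in
lemma φC_homTw (Y : EquivMod π) (g : G) {s t : O} (h : g • s = t) (f : R.X s ⟶ Y.M) :
    R.φC g h ≫ (R.homTw Y g h f).hom = f.hom ≫ Y.φ g :=
  letI := R.φC_isIso g h
  IsIso.hom_inv_id_assoc (R.φC g h) _

/-- The spaces `Hom(X_s, Y)` form a graded representation. -/
def homRep (hα : R.HasCocycle α) (Y : EquivMod π) : GradedRep α⁻¹ where
  W s := R.X s ⟶ Y.M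
  tw g {s t} h := R.homTw Y g h
  tw_mul g h {s t r} h1 h2 h3 f := by
    have := R.φC_isIso g h2
    have := R.φC_isIso h h1
    refine Mod.hom_ext _ _ ?_
    -- The maps `φ_s(g)` enter through their inverses, so their cocycle `α` appears here as `α⁻¹`.
    rw [← cancel_epi (R.φC g h2), ← cancel_epi (R.φC h h1), φC_homTw,
      reassoc_of% (φC_homTw Y h h1 f), mod_smul_hom', Linear.comp_smul, Linear.comp_smul,
      reassoc_of% (hα g h h1 h2 h3), Linear.smul_comp, φC_homTw, Y.φ_mul, smul_smul,
      TwoCocycle.inv_apply, ← Units.val_mul, inv_mul_cancel, Units.val_one, one_smul]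
  tw_one {s} h f := by
    have := R.φC_isIso 1 h
    refine Mod.hom_ext _ _ ?_
    rw [← cancel_epi (R.φC 1 h), φC_homTw, mod_smul_hom', Linear.comp_smul, hα.φC_one,
      Linear.smul_comp, smul_smul, TwoCocycle.inv_apply, ← Units.val_mul, inv_mul_cancel,
      Units.val_one, one_smul, Y.φ_one, Category.comp_id, Category.id_comp]

variable {R} {V : TwistedRep α⁻¹} {Y : EquivMod π}

/-- The morphism `V_s ⊠ X_s ⟶ Y` given by a linear map `V_s → Hom(X_s, Y)`. -/
def boxEv {W : Type*} [AddCommGroup W] [Module ℂ W] [FiniteDimensional ℂ W] {X Z : Mod C A}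
    (ψ : W →ₗ[ℂ] (X ⟶ Z)) : (box W X).X ⟶ Z.X :=
  ∑ i, boxπ W X i ≫ (ψ (Module.finBasis ℂ W i)).hom

lemma boxι_boxEv {W : Type*} [AddCommGroup W] [Module ℂ W] [FiniteDimensional ℂ W] {X Z : Mod C A}
    (ψ : W →ₗ[ℂ] (X ⟶ Z)) (i) : boxι W X i ≫ boxEv ψ = (ψ (Module.finBasis ℂ W i)).hom :=
  boxι_comp_sum _ i

lemma boxEv_linear {W : Type*} [AddCommGroup W] [Module ℂ W] [FiniteDimensional ℂ W]
    {X Z : Mod C A} (ψ : W →ₗ[ℂ] (X ⟶ Z)) :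
    γ[A, (box W X).X] ≫ boxEv ψ = A ◁ boxEv ψ ≫ γ[A, Z.X] := by
  rw [boxEv, Preadditive.comp_sum, whiskerLeft_sum, Preadditive.sum_comp]
  refine Finset.sum_congr rfl fun i _ => ?_
  rw [reassoc_of% (box_smul_π W X i), mod_smul_hom, MonoidalCategory.whiskerLeft_comp,
    Category.assoc]

lemma boxMap_boxEv {W W' : Type*} [AddCommGroup W] [Module ℂ W] [FiniteDimensional ℂ W]
    [AddCommGroup W'] [Module ℂ W'] [FiniteDimensional ℂ W'] {X X' Z : Mod C A}
    (L : W →ₗ[ℂ] W') (f : X.X ⟶ X'.X) (ψ : W' →ₗ[ℂ] (X' ⟶ Z)) (i) :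
    boxι W X i ≫ boxMap L f ≫ boxEv ψ = f ≫ (ψ (L (Module.finBasis ℂ W i))).hom := by
  have h : ∀ x : W', (ψ x).hom =
      ∑ j, (Module.finBasis ℂ W').repr x j • (ψ (Module.finBasis ℂ W' j)).hom := fun x => by
    conv_lhs => rw [← (Module.finBasis ℂ W').sum_repr x]
    rw [map_sum]
    refine (map_sum (modHomAddHom X' Z) _ _).trans (Finset.sum_congr rfl fun j _ => ?_)
    rw [map_smul]
    rfl
  rw [h, boxEv, Preadditive.comp_sum, Preadditive.comp_sum, Preadditive.comp_sum]
  refine Finset.sum_congr rfl fun j _ => ?_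
  have e := boxι_boxMap_π L f i j
  rw [← Category.assoc, ← Category.assoc, Category.assoc _ _ (boxπ W' X' j), e, Linear.smul_comp,
    Linear.comp_smul]

variable (ψ : ∀ s, V.comp s →ₗ[ℂ] (R.X s ⟶ Y.M))

/-- The morphism `X_{V,O} ⟶ Y` in `C` given by a family of linear maps `V_s → Hom(X_s, Y)`. -/
def evC [Fintype O] : (R.sumMod V).X ⟶ Y.M.X := ∑ s, R.sumπ V s ≫ boxEv (ψ s)

lemma sumι_evC [Fintype O] (s : O) : R.sumι V s ≫ evC ψ = boxEv (ψ s) := by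
  rw [evC, Preadditive.comp_sum, Finset.sum_eq_single s]
  · rw [reassoc_of% (R.sumι_π_self V)]
  · intro t _ ht
    rw [reassoc_of% (R.sumι_π_ne V ht.symm), zero_comp]
  · simp

lemma evC_linear [Fintype O] :
    γ[A, (R.sumMod V).X] ≫ evC ψ = A ◁ evC ψ ≫ γ[A, Y.M.X] := by
  rw [evC, Preadditive.comp_sum, whiskerLeft_sum, Preadditive.sum_comp]
  refine Finset.sum_congr rfl fun s _ => ?_
  rw [reassoc_of% (R.sum_smul_π V s), boxEv_linear, MonoidalCategory.whiskerLeft_comp,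
    Category.assoc]

lemma evC_comm [Fintype O] (hψ : ∀ (g : G) {s t : O} (h : g • s = t) (x : V.comp s),
      ψ t (V.act g h x) = R.homTw Y g h (ψ s x)) (g : G) :
    R.sumφ V g ≫ evC ψ = evC ψ ≫ Y.φ g := by
  refine R.sum_hom_ext' fun s => box_hom_ext' fun i => ?_
  rw [reassoc_of% (R.sumι_φ V g (rfl : g • s = g • s)), sumι_evC, boxMap_boxEv, hψ, φC_homTw,
    reassoc_of% (sumι_evC ψ s), reassoc_of% (boxι_boxEv (ψ s) i)]

/-- Restricting the evaluation to the copies of `X_s` recovers the values of `ψ s` on a basis. -/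
lemma eq_zero_of_evC_eq_zero [Fintype O] (h : evC ψ = 0) (s : O) : ψ s = 0 := by
  refine (Module.finBasis ℂ (V.comp s)).ext fun i => Mod.hom_ext _ _ ?_
  rw [← boxι_boxEv (ψ s) i, ← sumι_evC, h, comp_zero, comp_zero]
  rfl

/-- A simple object of `D` that contains some `X_s` is of the form `X_{V,O}` with `V`
irreducible. -/
theorem exists_iso_obj [∀ X Y : C, FiniteDimensional ℂ (X ⟶ Y)] [HasKernels (Mod C A)]
    [HasKernels (EquivMod π)] (hα : R.HasCocycle α) (hS : ∀ s, Simple (R.X s))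
    (hne : ∀ s t, Nonempty (R.X s ≅ R.X t) → s = t) (hD : IsVonNeumannRegular (EquivMod π))
    [Simple Y] (s₀ : O) (f₀ : R.X s₀ ⟶ Y.M) (hf₀ : f₀ ≠ 0) :
    ∃ V : TwistedRep α⁻¹, V.IsIrreducible ∧ Nonempty (Y ≅ R.obj hα V) := by
  have := Fintype.ofFinite O
  have : ∀ s, FiniteDimensional ℂ ((R.homRep hα Y).W s) := fun s =>
    inferInstanceAs (FiniteDimensional ℂ (R.X s ⟶ Y.M))
  have : Nontrivial ((R.homRep hα Y).W s₀) := ⟨f₀, (0 : R.X s₀ ⟶ Y.M), hf₀⟩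
  obtain ⟨V, ψ, hV, hψ, s, hs⟩ := (R.homRep hα Y).exists_irreducible s₀
  let F : R.obj hα V ⟶ Y :=
    { f := modHom (M := R.sumMod V) (evC ψ) (evC_linear ψ)
      comm := fun g => evC_comm ψ hψ g }
  have hF : F ≠ 0 := fun h => by
    have h0 : evC ψ = 0 := congrArg (fun F => F.f.hom) h
    exact hs (eq_zero_of_evC_eq_zero ψ h0 s)
  have := simple_obj hα hS hne hD hV
  have := isIso_of_hom_simple hF
  exact ⟨V, hV, ⟨(asIso F).symm⟩⟩

end TwistedFamily

end

end Orbifold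

namespace Orbifold

open scoped MonObj

set_option linter.unusedSectionVars false

/-! ### Choices of representatives on an orbit -/

section Orbits

lemma orbit_eq_of_coe_eq {G S : Type*} [Group G] [MulAction G S]
    {O O' : MulAction.orbitRel.Quotient G S} (s : O.orbit) (s' : O'.orbit)
    (h : (s : S) = s') : O = O' := by
  rw [← MulAction.orbitRel.Quotient.mem_orbit.mp s.2, h,
    MulAction.orbitRel.Quotient.mem_orbit.mp s'.2]

variable {C : Type u} [Category.{v} C] [MonoidalCategory C] [Preadditive C]
  [MonoidalPreadditive C] {A : C} [MonObj A] {G : Type w} [Group G] {π : G →* Aut (Mon.mk A)}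

lemma OrbitReps.coe_eq_of_iso {O O' : MulAction.orbitRel.Quotient G (SimpleClass (repAction π))}
    (R : OrbitReps π O) (R' : OrbitReps π O') {s : O.orbit} {s' : O'.orbit}
    (h : Nonempty (R.X s ≅ R'.X s')) : s.1 = s'.1 := by
  rw [← R.class_eq s, ← R'.class_eq s', SimpleClass.mk_eq_iff]
  exact h

variable [BraidedCategory C]

lemma OrbitReps₀.coe_eq_of_iso
    {O O' : MulAction.orbitRel.Quotient G (SimpleClass (rep₀Action π))}
    (R : OrbitReps₀ π O) (R' : OrbitReps₀ π O') {s : O.orbit} {s' : O'.orbit}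
    (h : Nonempty (R.X s ≅ R'.X s')) : s.1 = s'.1 := by
  rw [← R.class_eq s, ← R'.class_eq s', SimpleClass.mk_eq_iff]
  exact ⟨(Orbifold.isLocal A).isoMk h.some⟩

lemma nonempty_iso_iff_fullSubcategory {E : Type u} [Category.{v} E] (P : ObjectProperty E)
    (X Y : P.FullSubcategory) : Nonempty (X ≅ Y) ↔ Nonempty (X.obj ≅ Y.obj) :=
  ⟨fun ⟨e⟩ => ⟨P.ι.mapIso e⟩, fun ⟨e⟩ => ⟨P.isoMk e⟩⟩

/-- The underlying module of a simple object of `D` contains a simple module. -/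
lemma EquivMod.exists_simple_retract (h : IsVonNeumannRegular (Mod C A)) {l : Mod C A → ℕ}
    (hl : IsRetractLength l) (Y : EquivMod π) [Simple Y] :
    ∃ (S : Mod C A) (r : Retract S Y.M), Simple S ∧ r.i ≠ 0 := by
  obtain ⟨S, i, r, hS, hir⟩ := h.exists_simple hl Y.M fun e =>
    id_nonzero Y (EquivMod.hom_ext _ _ e)
  exact ⟨S, ⟨i, r, hir⟩, hS, simple_retract_nonzero i r hS hir⟩

end Orbits

end Orbifold

/-! ### The main theorem -/

theorem mainTheorem8 {C : Type u} [Category.{v} C] [Preadditive C] [HasFiniteBiproducts C]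
    [Linear ℂ C]
    [∀ X Y : C, FiniteDimensional ℂ (X ⟶ Y)]
    [MonoidalCategory C] [MonoidalPreadditive C] [MonoidalLinear ℂ C]
    [BraidedCategory C] [RigidCategory C] [Simple (𝟙_ C)]
    (hC : Orbifold.IsSemisimpleCat C) (θ : Orbifold.Balancing C)
    {A : C} [MonObj A] [IsCommMonObj A]
    (hA : Orbifold.IsRigidAlgebra θ A) (hθ : θ.θ.hom.app A = 𝟙 A)
    {G : Type w} [Group G] [Fintype G] (π : G →* Aut (Mon.mk A))
    (hπ : Function.Injective π) (hinv : Orbifold.InvariantsEqUnit π) :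
    -- `D` and `D⁰` are semisimple
    Orbifold.IsSemisimpleCat (Orbifold.EquivMod π) ∧
    Orbifold.IsSemisimpleCat (Orbifold.EquivMod₀ π) ∧
    -- simple objects of `D`, for every choice of representatives `X_s` and isomorphisms `φ_s(g)`
    (∀ R : ∀ O, Orbifold.OrbitReps π O,
      (∀ O, ∃! α, (R O).HasCocycle α) ∧
      ∀ (α : ∀ O, Orbifold.TwoCocycle G O.orbit) (hα : ∀ O, (R O).HasCocycle (α O)),
        (∀ O (V : Orbifold.TwistedRep (α O)⁻¹), V.IsIrreducible →
          Simple ((R O).obj (hα O) V)) ∧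
        (∀ Y : Orbifold.EquivMod π, Simple Y →
          ∃ O, ∃ V : Orbifold.TwistedRep (α O)⁻¹, V.IsIrreducible ∧
            Nonempty (Y ≅ (R O).obj (hα O) V)) ∧
        (∀ O O' (V : Orbifold.TwistedRep (α O)⁻¹) (V' : Orbifold.TwistedRep (α O')⁻¹),
          V.IsIrreducible → V'.IsIrreducible →
          Nonempty ((R O).obj (hα O) V ≅ (R O').obj (hα O') V') → O = O') ∧
        (∀ O (V V' : Orbifold.TwistedRep (α O)⁻¹), V.IsIrreducible → V'.IsIrreducible →
          (Nonempty ((R O).obj (hα O) V ≅ (R O).obj (hα O) V') ↔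
            Nonempty (V ≃ₗ[Orbifold.TwistedAlg (α O)⁻¹] V')))) ∧
    -- simple objects of `D⁰`
    (∀ R : ∀ O, Orbifold.OrbitReps₀ π O,
      (∀ O, ∃! α, (R O).HasCocycle α) ∧
      ∀ (α : ∀ O, Orbifold.TwoCocycle G O.orbit) (hα : ∀ O, (R O).HasCocycle (α O)),
        (∀ O (V : Orbifold.TwistedRep (α O)⁻¹), V.IsIrreducible →
          Simple ((R O).obj₀ (R O).isLocal (hα O) V)) ∧
        (∀ Y : Orbifold.EquivMod₀ π, Simple Y →
          ∃ O, ∃ V : Orbifold.TwistedRep (α O)⁻¹, V.IsIrreducible ∧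
            Nonempty (Y ≅ (R O).obj₀ (R O).isLocal (hα O) V)) ∧
        (∀ O O' (V : Orbifold.TwistedRep (α O)⁻¹) (V' : Orbifold.TwistedRep (α O')⁻¹),
          V.IsIrreducible → V'.IsIrreducible →
          Nonempty ((R O).obj₀ (R O).isLocal (hα O) V ≅ (R O').obj₀ (R O').isLocal (hα O') V') →
            O = O') ∧
        (∀ O (V V' : Orbifold.TwistedRep (α O)⁻¹), V.IsIrreducible → V'.IsIrreducible →
          (Nonempty ((R O).obj₀ (R O).isLocal (hα O) V ≅
              (R O).obj₀ (R O).isLocal (hα O) V') ↔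
            Nonempty (V ≃ₗ[Orbifold.TwistedAlg (α O)⁻¹] V')))) := by
  open Orbifold in
  have := hC.isIdempotentComplete
  have hMod : IsVonNeumannRegular (Mod C A) := hC.isVonNeumannRegular.mod hA hθ
  have hD : IsVonNeumannRegular (EquivMod π) := hMod.equivMod π
  have hkMod : HasKernels (Mod C A) := hMod.hasKernels
  have hkD : HasKernels (EquivMod π) := hD.hasKernels
  have hl := (isRetractLength_finrank_end (C := C)).comp (Mod.forget A : Mod C A ⥤ C)
  refine ⟨isSemisimpleCat_equivMod hC hA hθ π, isSemisimpleCat_equivMod₀ hC hA hθ π, fun R => ?_,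
    fun R => ?_⟩
  · have hS := fun O => (R O).simple
    have hne : ∀ O s t, Nonempty ((R O).X s ≅ (R O).X t) → s = t := fun O s t h =>
      Subtype.ext ((R O).coe_eq_of_iso (R O) h)
    refine ⟨fun O => (R O).existsUnique_hasCocycle (hS O), fun α hα => ⟨fun O V hV =>
      TwistedFamily.simple_obj (hα O) (hS O) (hne O) hD hV, fun Y hY => ?_,
      fun O O' V V' hV hV' ⟨e⟩ => ?_,
      fun O V V' _ _ => TwistedFamily.nonempty_obj_iso_iff (hα O) (hS O) (hne O)⟩⟩
    · obtain ⟨S, r, hSS, hr⟩ := Y.exists_simple_retract hMod hl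
      -- The orbit attached to `Y` is that of a simple module `S` contained in `Y`; the chosen
      -- representative of the class of `S` then maps nontrivially to `Y`.
      let O : MulAction.orbitRel.Quotient G (SimpleClass (repAction π)) :=
        Quotient.mk'' (SimpleClass.mk (repAction π) S hSS)
      let s : O.orbit := ⟨_, MulAction.orbitRel.Quotient.mem_orbit.mpr rfl⟩
      obtain ⟨e⟩ := (SimpleClass.mk_eq_iff _ _ _).mp ((R O).class_eq s)
      exact ⟨O, TwistedFamily.exists_iso_obj (hα O) (hS O) (hne O) hD s (e.hom ≫ r.i)
        (by rwa [Ne, Preadditive.IsIso.comp_left_eq_zero])⟩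
    · obtain ⟨s, s', h⟩ := TwistedFamily.exists_iso_of_obj_iso (hα O) (hα O') (hS O) (hS O')
        (TwistedFamily.simple_obj (hα O) (hS O) (hne O) hD hV) e
      exact orbit_eq_of_coe_eq s s' ((R O).coe_eq_of_iso (R O') h)
  -- The case of `D⁰` reduces to the arguments in `D`: the modules `X_s`, simple in `Rep⁰ A`, are
  -- also simple in `Rep A`.
  · have hS : ∀ O s, Simple ((R O).X s) := fun O s =>
      (hMod.simple_fullSubcategory_iff (isLocal A) ⟨(R O).X s, (R O).isLocal s⟩).mp ((R O).simple s)
    have hne : ∀ O s t, Nonempty ((R O).X s ≅ (R O).X t) → s = t := fun O s t h =>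
      Subtype.ext ((R O).coe_eq_of_iso (R O) h)
    refine ⟨fun O => (R O).existsUnique_hasCocycle (hS O), fun α hα => ⟨fun O V hV =>
      (hD.simple_fullSubcategory_iff (isLocalEquiv π) _).mpr
        (TwistedFamily.simple_obj (hα O) (hS O) (hne O) hD hV), fun Y hY => ?_,
      fun O O' V V' hV hV' ⟨e⟩ => ?_, fun O V V' _ _ => ?_⟩⟩
    · have hY' : Simple Y.obj := (hD.simple_fullSubcategory_iff (isLocalEquiv π) Y).mp hY
      obtain ⟨S, r, hSS, hr⟩ := Y.obj.exists_simple_retract hMod hl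
      -- `S` is a retract of a local module, so its class belongs to `S⁰`.
      have hSl : isLocal A S := (isLocal A).prop_of_retract r Y.2
      have hSS' : Simple (⟨S, hSl⟩ : Rep₀ A) :=
        (hMod.simple_fullSubcategory_iff (isLocal A) _).mpr hSS
      let O : MulAction.orbitRel.Quotient G (SimpleClass (rep₀Action π)) :=
        Quotient.mk'' (SimpleClass.mk (rep₀Action π) ⟨S, hSl⟩ hSS')
      let s : O.orbit := ⟨_, MulAction.orbitRel.Quotient.mem_orbit.mpr rfl⟩
      obtain ⟨e⟩ := (nonempty_iso_iff_fullSubcategory _ _ _).mp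
        ((SimpleClass.mk_eq_iff _ _ _).mp ((R O).class_eq s))
      obtain ⟨V, hV, h⟩ := TwistedFamily.exists_iso_obj (hα O) (hS O) (hne O) hD s (e.hom ≫ r.i)
        (by rwa [Ne, Preadditive.IsIso.comp_left_eq_zero])
      exact ⟨O, V, hV, (nonempty_iso_iff_fullSubcategory _ _ _).mpr h⟩
    · obtain ⟨s, s', h⟩ := TwistedFamily.exists_iso_of_obj_iso (hα O) (hα O') (hS O) (hS O')
        (TwistedFamily.simple_obj (hα O) (hS O) (hne O) hD hV) ((isLocalEquiv π).ι.mapIso e)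
      exact orbit_eq_of_coe_eq s s' ((R O).coe_eq_of_iso (R O') h)
    · exact (nonempty_iso_iff_fullSubcategory _ _ _).trans
        (TwistedFamily.nonempty_obj_iso_iff (hα O) (hS O) (hne O))
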